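/- Let $B\subset\mathbb R^3$ be a body: a closed three-dimensional embedded submanifold of Euclidean space with smooth boundary $\partial B$ and non-empty connected interior. A deformation of $B$ is a smooth injective map $\varphi:B\to\mathbb R^3$ whose deformation gradient $F=D\varphi$ is invertible at every point of $B$; it is homogeneous if $\varphi(X)=AX+x_0$ on $B$ for some constant linear map $A$ and vector $x_0$. A residual stress on $B$ is a smooth symmetric tensor field $\mathring S$ on $B$ with $\operatorname{Div}\mathring S=0$ in the interior of $B$ and $\mathring S N=0$ on $\partial B$, where $N$ is the outward unit normal. Put $b=FF^{\mathsf T}$, $c=b^{-1}$ and $\mathring\sigma=F\mathring SF^{\mathsf T}$, regarded as fields on $\varphi(B)$. In a homogeneous compressible isotropic Cauchy elastic solid with residual stress $\mathring S$ the Cauchy stress is $$\sigma=\alpha_0 1+\alpha_1 b+\alpha_2 c+\alpha_3\mathring\sigma+\alpha_4\mathring\sigma^2+\alpha_5(b\mathring\sigma+\mathring\sigma b)+\alpha_6(c\mathring\sigma+\mathring\sigma c)+\alpha_7(b\mathring\sigma^2+\mathring\sigma^2b),$$ where $\alpha_i=\alpha_i(I_1,\dots,I_{10})$, $i=0,\dots,7$,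 are arbitrary smooth functions on $\{I\in\mathbb R^{10}: I_1,I_2,I_3>0\}$, evaluated at the invariants $I_1=\operatorname{tr}b$, $I_2=\tfrac12(I_1^2-\operatorname{tr}b^2)$, $I_3=\det b$, $I_4=\operatorname{tr}\mathring\sigma$, $I_5=\operatorname{tr}\mathring\sigma^2$, $I_6=\operatorname{tr}\mathring\sigma^3$, $I_7=\operatorname{tr}(b\mathring\sigma)$, $I_8=\operatorname{tr}(b^2\mathring\sigma)$, $I_9=\operatorname{tr}(b\mathring\sigma^2)$, $I_{10}=\operatorname{tr}(b^2\mathring\sigma^2)$. A deformation $\varphi$ and a residual stress $\mathring S$ form a universal pair if, for every choice of the response functions $\alpha_0,\dots,\alpha_7$, the equilibrium equations without body forces, $\operatorname{div}\sigma=0$, hold in $\varphi(\operatorname{int}B)$. A deformation is universal if it forms a universal pair with some residual stress, and a residual stress is universal if it forms a universal pair with some deformation. Then: 1. A deformation of $B$ is universal if and only if it is homogeneous. 2. If moreover $B$ is bounded, then every universal residual stress on $B$ is homogeneous (constant on $B$); in fact, the only universal residual stress on $B$ is $\mathring S=0$, so there are no non-trivial universal residual stresses. -/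

import Mathlib

open scoped ContDiff Matrix Topology

noncomputable section

namespace ResidualElasticity

/-- Euclidean three-space, with its Cartesian coordinates. -/
abbrev E3 : Type := EuclideanSpace ℝ (Fin 3)

/-- Cartesian components of a second-order tensor. -/
abbrev Tensor2 : Type := Matrix (Fin 3) (Fin 3) ℝ

/-- The Cartesian basis vectors. -/
def basisVec (i : Fin 3) : E3 := EuclideanSpace.single i 1

/-! ### Bodies -/

/-- `ρ` is a smooth local defining function of `B` at `p`: it vanishes at `p`, has non-zero
gradient there, and near `p` the set `B` is `{ρ ≤ 0}`. -/
def IsLocalDefiningFunction (B : Set E3) (p : E3) (ρ : E3 → ℝ) : Prop :=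
  ContDiff ℝ ∞ ρ ∧ ρ p = 0 ∧ gradient ρ p ≠ 0 ∧ ∀ᶠ x in 𝓝 p, (x ∈ B ↔ ρ x ≤ 0)

/-- A (reference configuration of a) body: a closed three-dimensional embedded submanifold of
Euclidean space with (possibly empty) smooth boundary `frontier B` and with non-empty connected
interior. Boundedness is not part of this definition. -/
structure IsBody (B : Set E3) : Prop where
  isClosed : IsClosed B
  isConnected_interior : IsConnected (interior B)
  smooth_boundary : ∀ p ∈ frontier B, ∃ ρ, IsLocalDefiningFunction B p ρ

/-- `N` is the outward unit normal of `B` at the boundary point `p`. -/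
def IsOutwardUnitNormal (B : Set E3) (p N : E3) : Prop :=
  ∃ ρ, IsLocalDefiningFunction B p ρ ∧ N = ‖gradient ρ p‖⁻¹ • gradient ρ p

/-! ### Deformations -/

/-- The deformation gradient `F a A = ∂φ^a/∂X^A` at a point `X` of `B`. -/
def deformationGradient (B : Set E3) (φ : E3 → E3) (X : E3) : Tensor2 :=
  Matrix.of fun a A => (fderivWithin ℝ φ B X (basisVec A)) a

/-- A deformation of `B`: a smooth map (up to the boundary), one-to-one, with everywhere
invertible deformation gradient. Only its values on `B` matter. -/
structure IsDeformation (B : Set E3) (φ : E3 → E3) : Prop where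
  smooth : ContDiffOn ℝ ∞ φ B
  injOn : Set.InjOn φ B
  det_ne_zero : ∀ X ∈ B, (deformationGradient B φ X).det ≠ 0

/-- A homogeneous deformation: `x = A X + c` on the body. -/
def IsHomogeneousDeformation (B : Set E3) (φ : E3 → E3) : Prop :=
  ∃ (A : E3 →ₗ[ℝ] E3) (c : E3), ∀ X ∈ B, φ X = A X + c

/-! ### Residual stresses -/

/-- Divergence of a tensor field: `(div T)^a = ∂T^{ab}/∂x^b`. -/
def tensorDiv (T : E3 → Tensor2) (x : E3) (a : Fin 3) : ℝ :=
  ∑ b : Fin 3, fderiv ℝ (fun y => T y a b) x (basisVec b)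

/-- A residual stress on `B` (second Piola–Kirchhoff): a smooth symmetric tensor field which is
divergence-free in `B` and traction-free on the boundary. -/
structure IsResidualStress (B : Set E3) (S : E3 → Tensor2) : Prop where
  smooth : ∀ a b, ContDiffOn ℝ ∞ (fun X => S X a b) B
  symm : ∀ X ∈ B, (S X).IsSymm
  div_eq_zero : ∀ X ∈ interior B, ∀ a, tensorDiv S X a = 0
  traction_free : ∀ p ∈ frontier B, ∀ N : E3, IsOutwardUnitNormal B p N →
    S p *ᵥ (fun i => N i) = 0

/-- A tensor field that is uniform on `B`. -/
def IsHomogeneousField (B : Set E3) (S : E3 → Tensor2) : Prop :=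
  ∃ S₀ : Tensor2, ∀ X ∈ B, S X = S₀

/-! ### Constitutive law -/

/-- The ten invariants of `b` and `s`. -/
def invariants (b s : Tensor2) : Fin 10 → ℝ :=
  ![b.trace,
    (b.trace ^ 2 - (b * b).trace) / 2,
    b.det,
    s.trace,
    (s * s).trace,
    (s * s * s).trace,
    (b * s).trace,
    (b * b * s).trace,
    (b * (s * s)).trace,
    (b * b * (s * s)).trace]

/-- Domain of the response functions: the three principal invariants of the positive definite
tensor `b` are positive. -/
def invariantDomain : Set (Fin 10 → ℝ) := {I | 0 < I 0 ∧ 0 < I 1 ∧ 0 < I 2}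

/-- Eight response functions `α₀, …, α₇`, each a smooth function of the ten invariants. They do
not depend on the point, i.e. the solid is homogeneous. -/
def IsResponse (α : Fin 8 → (Fin 10 → ℝ) → ℝ) : Prop :=
  ∀ i, ContDiffOn ℝ ∞ (α i) invariantDomain

/-- The Cauchy stress as an isotropic function of `b` and `s`; here `c = b⁻¹`. -/
def stressFunction (α : Fin 8 → (Fin 10 → ℝ) → ℝ) (b s : Tensor2) : Tensor2 :=
  let I := invariants b s
  let c := b⁻¹
  α 0 I • (1 : Tensor2) + α 1 I • b + α 2 I • c + α 3 I • s + α 4 I • (s * s)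
    + α 5 I • (b * s + s * b) + α 6 I • (c * s + s * c)
    + α 7 I • (b * (s * s) + s * s * b)

/-- Left Cauchy–Green tensor `b = F Fᵀ`, at the material point `X`. -/
def leftCauchyGreen (B : Set E3) (φ : E3 → E3) (X : E3) : Tensor2 :=
  deformationGradient B φ X * (deformationGradient B φ X)ᵀ

/-- Push-forward `F S Fᵀ` of the residual stress, at the material point `X`. -/
def pushedResidualStress (B : Set E3) (φ : E3 → E3) (S : E3 → Tensor2) (X : E3) : Tensor2 :=
  deformationGradient B φ X * S X * (deformationGradient B φ X)ᵀ

/-- The Cauchy stress, as a field on the deformed configuration `φ '' B`. -/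
def cauchyStress (α : Fin 8 → (Fin 10 → ℝ) → ℝ) (B : Set E3) (φ : E3 → E3) (S : E3 → Tensor2)
    (x : E3) : Tensor2 :=
  let X := Function.invFunOn φ B x
  stressFunction α (leftCauchyGreen B φ X) (pushedResidualStress B φ S X)

/-! ### Universality -/

/-- The deformation `φ` and the residual stress `S` form a universal pair: in the absence of body
forces the equilibrium equations `div σ = 0` hold in the deformed configuration for every choice
of the response functions. -/
structure IsUniversalPair (B : Set E3) (φ : E3 → E3) (S : E3 → Tensor2) : Prop where
  isDeformation : IsDeformation B φ
  isResidualStress : IsResidualStress B S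
  equilibrium : ∀ α, IsResponse α →
    ∀ x ∈ φ '' interior B, ∀ a, tensorDiv (cauchyStress α B φ S) x a = 0

def IsUniversalDeformation (B : Set E3) (φ : E3 → E3) : Prop :=
  ∃ S, IsUniversalPair B φ S

def IsUniversalResidualStress (B : Set E3) (S : E3 → Tensor2) : Prop :=
  ∃ φ, IsUniversalPair B φ S

end ResidualElasticity

end

open ResidualElasticity

namespace ResidualElasticity

/-! ### Geometry of bodies -/

/-! For deformations this is Ericksen's argument, and two stresses that ignore the residual stress
suffice. Equilibrium of `(tr c) 1` and of `c` makes `tr c` locally constant and `c` divergence-free.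
Let `Y` be the inverse motion, so `c = (DY)ᵀ DY`. The two conditions give `ΔY = 0`; half the
Laplacian of `tr c` is then the sum of the squares of all second derivatives of `Y`, so these vanish
(`pd_pd_eq_zero_of_metric`). Connectedness of the interior makes `F` constant. Conversely, a
homogeneous deformation with zero residual stress has uniform Cauchy stress for every response.

For residual stresses, `F` is now constant, and the response giving the square of the pushed-forward
residual stress pulls back to `T = S Fᵀ F S`. It is divergence-free, and `S N = 0` gives `T N = 0`.
Each row of `T` is a divergence-free field tangent to the boundary; testing it against a coordinate
function shows that it has zero mean. Hence `tr T`, the squared Frobenius norm of `F S`, has zero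
integral and `S = 0`.

The zero-mean statement `setIntegral_eq_zero_of_div_eq_zero` avoids surface integrals. The field is
multiplied by a Lipschitz cutoff of the distance to the complement. In the boundary strip the field
is nearly tangential, so its product with the steep gradient of the cutoff stays bounded while the
volume of the strip tends to zero. -/

/-- Every point of a body lies in a convex subset of the body with non-empty interior. -/
theorem IsBody.exists_convex_subset {B : Set E3} (hB : IsBody B) {p : E3} (hp : p ∈ B) :
    ∃ s ⊆ B, Convex ℝ s ∧ (interior s).Nonempty ∧ p ∈ s := by
  by_cases hpi : p ∈ interior B
  · obtain ⟨r, hr, hrB⟩ := Metric.isOpen_iff.1 isOpen_interior p hpi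
    refine ⟨Metric.ball p r, hrB.trans interior_subset, convex_ball p r, ?_,
      Metric.mem_ball_self hr⟩
    rw [Metric.isOpen_ball.interior_eq]
    exact ⟨p, Metric.mem_ball_self hr⟩
  · have hpf : p ∈ frontier B := ⟨subset_closure hp, hpi⟩
    obtain ⟨ρ, hρ, hρp, hg, hiff⟩ := hB.smooth_boundary p hpf
    set g := gradient ρ p with hgdef
    have hgpos : 0 < ‖g‖ := norm_pos_iff.2 hg
    have hgrad : HasGradientAt ρ g p :=
      (hρ.contDiffAt.differentiableAt (by simp)).hasGradientAt
    have hlo := (hgrad.hasFDerivAt.isLittleO).def (half_pos hgpos)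
    obtain ⟨r, hr, hball⟩ := Metric.eventually_nhds_iff_ball.1 (hiff.and hlo)
    -- Near `p` the linearization error of `ρ` is at most half of `‖g‖ ‖x - p‖`, so a cone around
    -- `-g` forces `ρ ≤ 0`. Cut by a small ball, this cone is the required convex set.
    have hsub : ∀ x ∈ Metric.ball p r, inner ℝ g (x - p) + ‖g‖ / 2 * ‖x - p‖ ≤ 0 → x ∈ B := by
      intro x hx hle
      obtain ⟨h1, h2⟩ := hball x hx
      rw [h1]
      rw [hρp, Real.norm_eq_abs] at h2
      have h3 := (abs_le.1 h2).2
      simp only [InnerProductSpace.toDual_apply_apply] at h3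
      linarith
    refine ⟨{x | inner ℝ g (x - p) + ‖g‖ / 2 * ‖x - p‖ ≤ 0} ∩ Metric.ball p r,
      fun x hx => hsub x hx.2 hx.1, ?_, ?_, ?_⟩
    · refine Convex.inter ?_ (convex_ball p r)
      intro x hx y hy a b ha hb hab
      simp only [Set.mem_ofPred_eq] at hx hy ⊢
      have e : a • x + b • y - p = a • (x - p) + b • (y - p) := by
        have : p = a • p + b • p := by rw [← add_smul, hab, one_smul]
        conv_lhs => rw [this]
        module
      have hn : ‖a • (x - p) + b • (y - p)‖ ≤ a * ‖x - p‖ + b * ‖y - p‖ := by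
        refine (norm_add_le _ _).trans (le_of_eq ?_)
        rw [norm_smul, norm_smul, Real.norm_of_nonneg ha, Real.norm_of_nonneg hb]
      rw [e, inner_add_right, inner_smul_right, inner_smul_right]
      have h1 := mul_le_mul_of_nonneg_left hn (half_pos hgpos).le
      have h2 := mul_nonpos_of_nonneg_of_nonpos ha hx
      have h3 := mul_nonpos_of_nonneg_of_nonpos hb hy
      linarith
    · have ho : IsOpen ({x | inner ℝ g (x - p) + ‖g‖ / 2 * ‖x - p‖ < 0} ∩ Metric.ball p r) := by
        refine IsOpen.inter (isOpen_lt (by fun_prop) continuous_const) Metric.isOpen_ball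
      set t : ℝ := r / (2 * ‖g‖) with ht
      have htpos : 0 < t := by positivity
      have htg : t * ‖g‖ = r / 2 := by rw [ht]; field_simp
      refine ⟨p - t • g, interior_maximal ?_ ho ⟨?_, ?_⟩⟩
      · intro x hx
        simp only [Set.mem_inter_iff, Set.mem_ofPred_eq] at hx ⊢
        exact ⟨hx.1.le, hx.2⟩
      · simp only [Set.mem_ofPred_eq, sub_sub_cancel_left, inner_neg_right, inner_smul_right,
          real_inner_self_eq_norm_sq, norm_neg, norm_smul, Real.norm_of_nonneg htpos.le]
        have : 0 < t * ‖g‖ ^ 2 := by positivity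
        nlinarith
      · rw [Metric.mem_ball, dist_eq_norm, sub_sub_cancel_left, norm_neg, norm_smul,
          Real.norm_of_nonneg htpos.le, htg]
        linarith
    · exact ⟨by simp, Metric.mem_ball_self hr⟩

/-- A convex set with interior has a unique derivative at each of its points, and this passes to the
larger set `B`. It makes `fderivWithin` meaningful and continuous up to the boundary. -/
theorem IsBody.uniqueDiffOn {B : Set E3} (hB : IsBody B) : UniqueDiffOn ℝ B := by
  intro p hp
  obtain ⟨s, hsB, hs, hi, hps⟩ := hB.exists_convex_subset hp
  exact (uniqueDiffWithinAt_convex hs hi (subset_closure hps)).mono hsB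

theorem IsBody.closure_interior {B : Set E3} (hB : IsBody B) : closure (interior B) = B := by
  refine Set.Subset.antisymm (closure_minimal interior_subset hB.isClosed) fun p hp => ?_
  obtain ⟨s, hsB, hs, hi, hps⟩ := hB.exists_convex_subset hp
  have h := hs.closure_interior_eq_closure_of_nonempty_interior hi
  exact closure_mono (interior_mono hsB) (h ▸ subset_closure hps)

/-- Continuous fields that agree in the interior of a body agree on the body. -/
theorem IsBody.eqOn_of_eqOn_interior {B : Set E3} (hB : IsBody B) {Y : Type*}
    [TopologicalSpace Y] [T2Space Y] {f g : E3 → Y} (hf : ContinuousOn f B)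
    (hg : ContinuousOn g B) (h : Set.EqOn f g (interior B)) : Set.EqOn f g B :=
  h.of_subset_closure hf hg interior_subset hB.closure_interior.ge

/-! ### Partial derivatives of smooth functions on open sets -/

/-- The partial derivative `∂f/∂x^i`. -/
noncomputable def pd (i : Fin 3) (f : E3 → ℝ) (x : E3) : ℝ := fderiv ℝ f x (basisVec i)

section PartialDerivatives

variable {U : Set E3} {f g : E3 → ℝ}

theorem pd_congr (hU : IsOpen U) (h : Set.EqOn f g U) (i : Fin 3) :
    Set.EqOn (pd i f) (pd i g) U := by
  intro x hx
  unfold pd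
  rw [Filter.EventuallyEq.fderiv_eq (h.eventuallyEq_of_mem (hU.mem_nhds hx))]

theorem pd_eq_zero_of_const (hU : IsOpen U) {k : ℝ} (h : ∀ x ∈ U, f x = k) (i : Fin 3) :
    ∀ x ∈ U, pd i f x = 0 := by
  intro x hx
  rw [pd_congr hU (g := fun _ => k) h i hx]
  simp [pd]

theorem differentiableAt_of_smoothOn {G : Type*} [NormedAddCommGroup G] [NormedSpace ℝ G]
    {f : E3 → G} (hU : IsOpen U) (hf : ContDiffOn ℝ ∞ f U) {x : E3}
    (hx : x ∈ U) : DifferentiableAt ℝ f x :=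
  (hf.contDiffAt (hU.mem_nhds hx)).differentiableAt (by simp)

theorem contDiffOn_pd (hU : IsOpen U) (hf : ContDiffOn ℝ ∞ f U) (i : Fin 3) :
    ContDiffOn ℝ ∞ (pd i f) U :=
  (hf.fderiv_of_isOpen hU (by simp)).clm_apply contDiffOn_const

theorem pd_mul (hU : IsOpen U) (hf : ContDiffOn ℝ ∞ f U) (hg : ContDiffOn ℝ ∞ g U) (i : Fin 3)
    {x : E3} (hx : x ∈ U) :
    pd i (fun y => f y * g y) x = pd i f x * g x + f x * pd i g x := by
  unfold pd
  rw [fderiv_fun_mul (differentiableAt_of_smoothOn hU hf hx)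
    (differentiableAt_of_smoothOn hU hg hx)]
  simp
  ring

theorem pd_sum {ι : Type*} (s : Finset ι) {f : ι → E3 → ℝ} (hU : IsOpen U)
    (hf : ∀ j, ContDiffOn ℝ ∞ (f j) U) (i : Fin 3) {x : E3} (hx : x ∈ U) :
    pd i (fun y => ∑ j ∈ s, f j y) x = ∑ j ∈ s, pd i (f j) x := by
  unfold pd
  rw [fderiv_fun_sum fun j _ => differentiableAt_of_smoothOn hU (hf j) hx]
  simp

theorem pd_comm (hU : IsOpen U) (hf : ContDiffOn ℝ ∞ f U) (i j : Fin 3) {x : E3} (hx : x ∈ U) :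
    pd i (pd j f) x = pd j (pd i f) x := by
  have hc := hf.contDiffAt (hU.mem_nhds hx)
  have hs : IsSymmSndFDerivAt ℝ f x := hc.isSymmSndFDerivAt (by
    rw [minSmoothness_of_isRCLikeNormedField]; exact ENat.LEInfty.out)
  have hd : DifferentiableAt ℝ (fderiv ℝ f) x :=
    (hc.fderiv_right (m := ∞) (by simp)).differentiableAt (by simp)
  have key : ∀ k l : Fin 3,
      pd k (pd l f) x = fderiv ℝ (fderiv ℝ f) x (basisVec k) (basisVec l) := by
    intro k l
    unfold pd
    rw [fderiv_clm_apply hd (by fun_prop)]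
    simp
  rw [key, key, hs.eq]

theorem ext_basisVec {G : Type*} [NormedAddCommGroup G] [NormedSpace ℝ G] {l m : E3 →L[ℝ] G}
    (h : ∀ i, l (basisVec i) = m (basisVec i)) : l = m := by
  ext x
  have hx : x = ∑ i, x i • basisVec i := by
    ext j
    simp [basisVec, Finset.sum_apply, Pi.single_apply]
  rw [hx, map_sum, map_sum]
  simp [h]

/-- A smooth function on a connected open set whose partial derivatives vanish is constant. -/
theorem eq_of_pd_eq_zero (hU : IsOpen U) (hUc : IsPreconnected U) (hf : ContDiffOn ℝ ∞ f U)
    (h : ∀ i, ∀ x ∈ U, pd i f x = 0) {x y : E3} (hx : x ∈ U) (hy : y ∈ U) : f x = f y := by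
  refine hU.is_const_of_fderiv_eq_zero hUc
    (fun z hz => (differentiableAt_of_smoothOn hU hf hz).differentiableWithinAt) ?_ hx hy
  intro z hz
  exact ext_basisVec fun i => by simpa [pd] using h i z hz

end PartialDerivatives

/-! ### Ericksen's theorem in spatial coordinates -/

/-- If `c = (DY)ᵀ DY` is divergence-free with constant trace, and `DY` is invertible, then the
second derivatives of `Y` vanish. -/
theorem pd_pd_eq_zero_of_metric {U : Set E3} (hU : IsOpen U) {Y : Fin 3 → E3 → ℝ}
    (hY : ∀ A, ContDiffOn ℝ ∞ (Y A) U)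
    (hinv : ∀ x ∈ U, (Matrix.of fun A a => pd a (Y A) x).det ≠ 0)
    (htr : ∀ a, ∀ x ∈ U, pd a (fun y => ∑ b, ∑ A, pd b (Y A) y * pd b (Y A) y) x = 0)
    (hdiv : ∀ a, ∀ x ∈ U, ∑ b, pd b (fun y => ∑ A, pd a (Y A) y * pd b (Y A) y) x = 0)
    (A a b : Fin 3) : ∀ x ∈ U, pd a (pd b (Y A)) x = 0 := by
  have h1 : ∀ a A, ContDiffOn ℝ ∞ (pd a (Y A)) U := fun a A => contDiffOn_pd hU (hY A) a
  have h2 : ∀ a b A, ContDiffOn ℝ ∞ (pd a (pd b (Y A))) U :=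
    fun a b A => contDiffOn_pd hU (h1 b A) a
  -- Half the gradient of the trace.
  have htr' : ∀ a, ∀ x ∈ U, ∑ b, ∑ A, pd b (Y A) x * pd a (pd b (Y A)) x = 0 := by
    intro a x hx
    have := htr a x hx
    rw [pd_sum _ hU (fun b => ContDiffOn.sum fun A _ => (h1 b A).mul (h1 b A)) a hx] at this
    have e : ∀ b, pd a (fun y => ∑ A, pd b (Y A) y * pd b (Y A) y) x
        = 2 * ∑ A, pd b (Y A) x * pd a (pd b (Y A)) x := by
      intro b
      rw [pd_sum _ hU (fun A => (h1 b A).mul (h1 b A)) a hx, Finset.mul_sum]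
      refine Finset.sum_congr rfl fun A _ => ?_
      rw [pd_mul hU (h1 b A) (h1 b A) a hx]
      ring
    simp only [e, ← Finset.mul_sum] at this
    linarith
  -- By symmetry of second derivatives, `div c` is half the gradient of `tr c` plus the row vector
  -- `ΔY` times `DY`. The first term vanishes and `DY` is invertible.
  have hlap : ∀ x ∈ U, ∀ A, ∑ b, pd b (pd b (Y A)) x = 0 := by
    intro x hx
    have key : (fun A => ∑ b, pd b (pd b (Y A)) x) ᵥ* (Matrix.of fun A a => pd a (Y A) x) = 0 := by
      funext a
      have hd := hdiv a x hx
      have e : ∀ b, pd b (fun y => ∑ A, pd a (Y A) y * pd b (Y A) y) x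
          = ∑ A, pd b (Y A) x * pd a (pd b (Y A)) x
            + ∑ A, pd b (pd b (Y A)) x * pd a (Y A) x := by
        intro b
        rw [pd_sum _ hU (fun A => (h1 a A).mul (h1 b A)) b hx, ← Finset.sum_add_distrib]
        refine Finset.sum_congr rfl fun A _ => ?_
        rw [pd_mul hU (h1 a A) (h1 b A) b hx, pd_comm hU (hY A) b a hx]
        ring
      simp only [e] at hd
      rw [Finset.sum_add_distrib, htr' a x hx, zero_add, Finset.sum_comm] at hd
      simpa [Matrix.vecMul, dotProduct, Finset.sum_mul] using hd
    have := Matrix.eq_zero_of_vecMul_eq_zero (hinv x hx) key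
    exact fun A => congrFun this A
  -- Taking the divergence of `htr'` produces the squares and a term with `∂_b ΔY`, which vanishes
  -- by `hlap`.
  have hsq : ∀ x ∈ U, ∑ a, ∑ b, ∑ A, pd a (pd b (Y A)) x * pd a (pd b (Y A)) x = 0 := by
    intro x hx
    have e : ∀ a, ∑ b, ∑ A, (pd a (pd b (Y A)) x * pd a (pd b (Y A)) x
        + pd b (Y A) x * pd a (pd a (pd b (Y A))) x) = 0 := by
      intro a
      have := pd_eq_zero_of_const hU (htr' a) a x hx
      rw [pd_sum _ hU (fun b => ContDiffOn.sum fun A _ => (h1 b A).mul (h2 a b A)) a hx] at this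
      rw [← this]
      refine Finset.sum_congr rfl fun b _ => ?_
      rw [pd_sum _ hU (fun A => (h1 b A).mul (h2 a b A)) a hx]
      refine Finset.sum_congr rfl fun A _ => ?_
      rw [pd_mul hU (h1 b A) (h2 a b A) a hx]
    have hthird : ∀ b A, ∑ a, pd a (pd a (pd b (Y A))) x = 0 := by
      intro b A
      have := pd_eq_zero_of_const hU (fun y hy => hlap y hy A) b x hx
      rw [pd_sum _ hU (fun a => h2 a a A) b hx] at this
      rw [← this]
      refine Finset.sum_congr rfl fun a _ => ?_
      rw [pd_comm hU (h1 a A) b a hx]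
      exact pd_congr hU (fun y hy => pd_comm hU (hY A) a b hy) a hx
    have hsum := Finset.sum_eq_zero fun a (_ : a ∈ Finset.univ) => e a
    simp only [Finset.sum_add_distrib] at hsum
    have hz : ∑ a, ∑ b, ∑ A, pd b (Y A) x * pd a (pd a (pd b (Y A))) x = 0 := by
      rw [Finset.sum_comm]
      refine Finset.sum_eq_zero fun b _ => ?_
      rw [Finset.sum_comm]
      refine Finset.sum_eq_zero fun A _ => ?_
      rw [← Finset.mul_sum, hthird, mul_zero]
    rw [hz, add_zero] at hsum
    exact hsum
  intro x hx
  have n3 : ∀ a b A, 0 ≤ pd a (pd b (Y A)) x * pd a (pd b (Y A)) x :=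
    fun _ _ _ => mul_self_nonneg _
  have n2 := fun a b => Finset.sum_nonneg fun A (_ : A ∈ Finset.univ) => n3 a b A
  have n1 := fun a => Finset.sum_nonneg fun b (_ : b ∈ Finset.univ) => n2 a b
  have z1 := (Finset.sum_eq_zero_iff_of_nonneg fun a _ => n1 a).1 (hsq x hx) a (Finset.mem_univ _)
  have z2 := (Finset.sum_eq_zero_iff_of_nonneg fun b _ => n2 a b).1 z1 b (Finset.mem_univ _)
  have z3 := (Finset.sum_eq_zero_iff_of_nonneg fun A _ => n3 a b A).1 z2 A (Finset.mem_univ _)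
  exact mul_self_eq_zero.1 z3

/-! ### Kinematics -/

theorem apply_eq_mulVec (l : E3 →L[ℝ] E3) (v : E3) (a : Fin 3) :
    l v a = ((Matrix.of fun a A => l (basisVec A) a) *ᵥ (fun i => v i)) a := by
  have hv : v = ∑ i, v i • basisVec i := by
    ext j
    simp [basisVec, Finset.sum_apply, Pi.single_apply]
  conv_lhs => rw [hv, map_sum]
  simp [Matrix.mulVec, dotProduct, Finset.sum_apply, mul_comm]

/-- A linear map whose Cartesian matrix is invertible is a continuous linear equivalence. -/
theorem exists_equiv_of_det_ne_zero (l : E3 →L[ℝ] E3)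
    (h : (Matrix.of fun a A => l (basisVec A) a : Tensor2).det ≠ 0) :
    ∃ e : E3 ≃L[ℝ] E3, (e : E3 →L[ℝ] E3) = l := by
  have hinj : Function.Injective (l : E3 →ₗ[ℝ] E3) := by
    rw [← LinearMap.ker_eq_bot, LinearMap.ker_eq_bot']
    intro v hv
    have : (Matrix.of fun a A => l (basisVec A) a : Tensor2) *ᵥ (fun i => v i) = 0 := by
      funext a
      rw [← apply_eq_mulVec]
      have : l v = 0 := hv
      simp [this]
    have := Matrix.eq_zero_of_mulVec_eq_zero h this
    ext i
    exact congrFun this i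
  refine ⟨(LinearEquiv.ofInjectiveEndo _ hinj).toContinuousLinearEquiv, ?_⟩
  ext v
  rfl

section Deformation

variable {B : Set E3} {φ : E3 → E3} {X : E3}

theorem deformationGradient_of_mem_interior (φ : E3 → E3) (hX : X ∈ interior B) :
    deformationGradient B φ X = Matrix.of fun a A => fderiv ℝ φ X (basisVec A) a := by
  unfold deformationGradient
  rw [fderivWithin_of_mem_nhds (mem_interior_iff_mem_nhds.1 hX)]

theorem IsDeformation.contDiffAt (hφ : IsDeformation B φ) (hX : X ∈ interior B) :
    ContDiffAt ℝ ∞ φ X :=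
  hφ.smooth.contDiffAt (mem_interior_iff_mem_nhds.1 hX)

theorem IsDeformation.exists_equiv (hφ : IsDeformation B φ) (hX : X ∈ interior B) :
    ∃ e : E3 ≃L[ℝ] E3, HasFDerivAt φ (e : E3 →L[ℝ] E3) X := by
  have h := hφ.det_ne_zero X (interior_subset hX)
  rw [deformationGradient_of_mem_interior φ hX] at h
  obtain ⟨e, he⟩ := exists_equiv_of_det_ne_zero _ h
  exact ⟨e, he ▸ ((hφ.contDiffAt hX).differentiableAt (by simp)).hasFDerivAt⟩

/-- The inverse function theorem at an interior point. It makes the image of the interior open and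
lets neighbourhoods of `φ X` be tested in the reference configuration. -/
theorem IsDeformation.map_nhds (hφ : IsDeformation B φ) (hX : X ∈ interior B) :
    Filter.map φ (𝓝 X) = 𝓝 (φ X) := by
  obtain ⟨e, he⟩ := hφ.exists_equiv hX
  exact ((hφ.contDiffAt hX).hasStrictFDerivAt' he (by simp)).map_nhds_eq_of_equiv

theorem IsDeformation.isOpen_image (hφ : IsDeformation B φ) : IsOpen (φ '' interior B) := by
  rw [isOpen_iff_mem_nhds]
  rintro _ ⟨X, hX, rfl⟩
  rw [← hφ.map_nhds hX]
  exact Filter.image_mem_map (isOpen_interior.mem_nhds hX)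

theorem IsDeformation.invFunOn_apply (hφ : IsDeformation B φ) (hX : X ∈ B) :
    Function.invFunOn φ B (φ X) = X :=
  hφ.injOn.leftInvOn_invFunOn hX

theorem IsDeformation.contDiffOn_invFunOn (hφ : IsDeformation B φ) :
    ContDiffOn ℝ ∞ (Function.invFunOn φ B) (φ '' interior B) := by
  rintro _ ⟨X, hX, rfl⟩
  obtain ⟨e, he⟩ := hφ.exists_equiv hX
  have hc := hφ.contDiffAt hX
  refine ContDiffAt.contDiffWithinAt ((hc.to_localInverse he (by simp)).congr_of_eventuallyEq ?_)
  rw [Filter.EventuallyEq, ← hφ.map_nhds hX, Filter.eventually_map]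
  filter_upwards [(hc.hasStrictFDerivAt' he (by simp)).eventually_left_inverse,
    isOpen_interior.mem_nhds hX] with Z hZ hZB
  rw [hφ.invFunOn_apply (interior_subset hZB)]
  exact hZ.symm

/-- The components of the inverse motion. -/
noncomputable def inverseMotion (B : Set E3) (φ : E3 → E3) (A : Fin 3) (x : E3) : ℝ :=
  Function.invFunOn φ B x A

theorem IsDeformation.contDiffOn_inverseMotion (hφ : IsDeformation B φ) (A : Fin 3) :
    ContDiffOn ℝ ∞ (inverseMotion B φ A) (φ '' interior B) :=
  (contDiffOn_euclidean.1 hφ.contDiffOn_invFunOn) A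

end Deformation
-- Gradient of the inverse motion and the tensor `c`
section Inverse

variable {B : Set E3} {φ : E3 → E3} {S : E3 → Tensor2} {X : E3}

theorem clm_apply_eq_sum (l : E3 →L[ℝ] ℝ) (v : E3) : l v = ∑ a, l (basisVec a) * v a := by
  have hv : v = ∑ i, v i • basisVec i := by
    ext j
    simp [basisVec, Finset.sum_apply, Pi.single_apply]
  conv_lhs => rw [hv, map_sum]
  simp [mul_comm]

/-- The gradient of the inverse motion, as a matrix. -/
noncomputable def inverseGradient (B : Set E3) (φ : E3 → E3) (x : E3) : Tensor2 :=
  Matrix.of fun A a => pd a (inverseMotion B φ A) x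

theorem IsDeformation.inverseGradient_mul (hφ : IsDeformation B φ) (hX : X ∈ interior B) :
    inverseGradient B φ (φ X) * deformationGradient B φ X = 1 := by
  rw [deformationGradient_of_mem_interior φ hX]
  ext A C
  have hd := (hφ.contDiffAt hX).differentiableAt (by simp)
  have hY : DifferentiableAt ℝ (inverseMotion B φ A) (φ X) :=
    differentiableAt_of_smoothOn hφ.isOpen_image (hφ.contDiffOn_inverseMotion A)
      (Set.mem_image_of_mem φ hX)
  have hcomp : fderiv ℝ (inverseMotion B φ A ∘ φ) X = EuclideanSpace.proj (𝕜 := ℝ) A := by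
    have : inverseMotion B φ A ∘ φ =ᶠ[𝓝 X] fun Z => EuclideanSpace.proj (𝕜 := ℝ) A Z := by
      filter_upwards [isOpen_interior.mem_nhds hX] with Z hZ
      simp [inverseMotion, hφ.invFunOn_apply (interior_subset hZ)]
    rw [this.fderiv_eq]
    exact (EuclideanSpace.proj (𝕜 := ℝ) A).fderiv
  rw [fderiv_comp X hY hd] at hcomp
  have h := congrArg (fun l : E3 →L[ℝ] ℝ => l (basisVec C)) hcomp
  simp only [ContinuousLinearMap.comp_apply] at h
  rw [clm_apply_eq_sum] at h
  simpa [Matrix.mul_apply, inverseGradient, pd, Matrix.one_apply, basisVec, Pi.single_apply]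
    using h

theorem IsDeformation.inv_leftCauchyGreen (hφ : IsDeformation B φ) (hX : X ∈ interior B) :
    (leftCauchyGreen B φ X)⁻¹ = (inverseGradient B φ (φ X))ᵀ * inverseGradient B φ (φ X) := by
  have h := hφ.inverseGradient_mul hX
  have h' := mul_eq_one_comm.1 h
  have ht := congrArg Matrix.transpose h
  rw [Matrix.transpose_mul, Matrix.transpose_one] at ht
  refine Matrix.inv_eq_right_inv ?_
  unfold leftCauchyGreen
  calc _ = deformationGradient B φ X * ((deformationGradient B φ X)ᵀ
        * (inverseGradient B φ (φ X))ᵀ) * inverseGradient B φ (φ X) := by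
        simp only [Matrix.mul_assoc]
    _ = 1 := by rw [ht, Matrix.mul_one, h']

theorem IsDeformation.cauchyStress_apply (hφ : IsDeformation B φ) (hX : X ∈ B)
    (α : Fin 8 → (Fin 10 → ℝ) → ℝ) :
    cauchyStress α B φ S (φ X)
      = stressFunction α (leftCauchyGreen B φ X) (pushedResidualStress B φ S X) := by
  simp only [cauchyStress, hφ.invFunOn_apply hX]

end Inverse

/-! ### Invariants and special response functions -/

/-- The trace of the adjugate of a 3 × 3 matrix is its second principal invariant. Thus `tr c` is an
admissible function of the invariants. -/
theorem trace_inv_eq (b : Tensor2) :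
    (b⁻¹).trace = (b.trace ^ 2 - (b * b).trace) / 2 / b.det := by
  rw [Matrix.inv_def, Matrix.trace_smul, Ring.inverse_eq_inv', smul_eq_mul, div_eq_inv_mul]
  congr 1
  rw [Matrix.adjugate_fin_three]
  simp [Matrix.trace, Fin.sum_univ_three, Matrix.mul_apply]
  ring

/-- The response functions with `α k = f` and all the others zero. -/
def singleResponse (k : Fin 8) (f : (Fin 10 → ℝ) → ℝ) : Fin 8 → (Fin 10 → ℝ) → ℝ :=
  fun i I => if i = k then f I else 0

theorem isResponse_singleResponse (k : Fin 8) {f : (Fin 10 → ℝ) → ℝ}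
    (hf : ContDiffOn ℝ ∞ f invariantDomain) : IsResponse (singleResponse k f) := by
  intro i
  unfold singleResponse
  by_cases h : i = k
  · simpa [h] using hf
  · simpa [h] using contDiffOn_const

/-- Indices start at zero: `I 1 / I 2` is the second principal invariant over the determinant, that
is `tr c`. -/
theorem contDiffOn_quotient_invariant :
    ContDiffOn ℝ ∞ (fun I : Fin 10 → ℝ => I 1 / I 2) invariantDomain :=
  ContDiffOn.div (by fun_prop) (by fun_prop) fun _ hI => hI.2.2.ne'

theorem stressFunction_trace (b s : Tensor2) :
    stressFunction (singleResponse 0 fun I => I 1 / I 2) b s = (b⁻¹).trace • (1 : Tensor2) := by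
  simp [stressFunction, singleResponse, invariants, trace_inv_eq]

theorem stressFunction_inv (b s : Tensor2) :
    stressFunction (singleResponse 2 fun _ => 1) b s = b⁻¹ := by
  simp [stressFunction, singleResponse]

theorem stressFunction_sq (b s : Tensor2) :
    stressFunction (singleResponse 4 fun _ => 1) b s = s * s := by
  simp [stressFunction, singleResponse]

/-! ### Universal deformations are homogeneous -/

section Homogeneous

variable {B : Set E3} {φ : E3 → E3} {S : E3 → Tensor2}

theorem tensorDiv_eq_sum_pd (T : E3 → Tensor2) (x : E3) (a : Fin 3) :
    tensorDiv T x a = ∑ b, pd b (fun y => T y a b) x := rfl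

theorem IsUniversalPair.pd_pd_inverseMotion (h : IsUniversalPair B φ S) (A a b : Fin 3) :
    ∀ x ∈ φ '' interior B, pd a (pd b (inverseMotion B φ A)) x = 0 := by
  have hφ := h.isDeformation
  have hU := hφ.isOpen_image
  have hc : ∀ x ∈ φ '' interior B, ∀ a b,
      (leftCauchyGreen B φ (Function.invFunOn φ B x))⁻¹ a b
        = ∑ A, pd a (inverseMotion B φ A) x * pd b (inverseMotion B φ A) x := by
    rintro _ ⟨X, hX, rfl⟩ a b
    rw [hφ.invFunOn_apply (interior_subset hX), hφ.inv_leftCauchyGreen hX]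
    simp [Matrix.mul_apply, inverseGradient]
  refine pd_pd_eq_zero_of_metric hU hφ.contDiffOn_inverseMotion ?_ ?_ ?_ A a b
  · rintro _ ⟨X, hX, rfl⟩
    exact left_ne_zero_of_mul (b := (deformationGradient B φ X).det) (by
      rw [← Matrix.det_mul]
      exact (congrArg Matrix.det (hφ.inverseGradient_mul hX)).trans_ne (by simp))
  · intro a x hx
    -- For the spherical stress `(tr c) 1`, only the diagonal term of the divergence survives: the
    -- `a`-th derivative of `tr c`.
    have he := h.equilibrium _ (isResponse_singleResponse 0 contDiffOn_quotient_invariant) x hx a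
    rw [tensorDiv_eq_sum_pd, Finset.sum_eq_single a] at he
    · rw [← he]
      refine pd_congr hU (fun y hy => ?_) a hx
      simp only [cauchyStress, stressFunction_trace, Matrix.trace, Matrix.diag, hc y hy]
      simp
    · intro b _ hb
      refine pd_eq_zero_of_const hU (k := 0) (fun y _ => ?_) b x hx
      simp [cauchyStress, stressFunction_trace, hb.symm]
    · simp
  · intro a x hx
    -- Here the stress is `c` itself.
    have he := h.equilibrium _ (isResponse_singleResponse 2 (contDiffOn_const (c := (1 : ℝ)))) x hx a
    rw [tensorDiv_eq_sum_pd] at he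
    rw [← he]
    refine Finset.sum_congr rfl fun b _ => pd_congr hU (fun y hy => ?_) b hx
    simp only [cauchyStress, stressFunction_inv, hc y hy]

/-- The deformation gradient of a universal deformation is constant. -/
theorem IsUniversalPair.deformationGradient_eq (hB : IsBody B) (h : IsUniversalPair B φ S)
    {X Z : E3} (hX : X ∈ interior B) (hZ : Z ∈ interior B) :
    deformationGradient B φ X = deformationGradient B φ Z := by
  have hφ := h.isDeformation
  have hUc : IsPreconnected (φ '' interior B) :=
    hB.isConnected_interior.isPreconnected.image _
      (hφ.smooth.continuousOn.mono interior_subset)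
  have hG : inverseGradient B φ (φ X) = inverseGradient B φ (φ Z) := by
    ext A a
    exact eq_of_pd_eq_zero hφ.isOpen_image hUc
      (contDiffOn_pd hφ.isOpen_image (hφ.contDiffOn_inverseMotion A) a)
      (fun b => h.pd_pd_inverseMotion A b a) (Set.mem_image_of_mem φ hX)
      (Set.mem_image_of_mem φ hZ)
  have h1 := hφ.inverseGradient_mul hX
  rw [hG] at h1
  exact left_inv_eq_right_inv (mul_eq_one_comm.1 h1) (hφ.inverseGradient_mul hZ)

theorem IsUniversalPair.isHomogeneousDeformation (hB : IsBody B) (h : IsUniversalPair B φ S) :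
    IsHomogeneousDeformation B φ := by
  have hφ := h.isDeformation
  obtain ⟨Z, hZ⟩ := hB.isConnected_interior.nonempty
  set L := fderiv ℝ φ Z with hL
  refine ⟨L, φ Z - L Z, ?_⟩
  refine hB.eqOn_of_eqOn_interior hφ.smooth.continuousOn
    (by simp only [ContinuousLinearMap.coe_coe]; fun_prop) ?_
  intro X hX
  have hd : ∀ Y ∈ interior B, DifferentiableAt ℝ φ Y := fun Y hY =>
    (hφ.contDiffAt hY).differentiableAt (by simp)
  -- `φ - L` has zero derivative on the connected interior; closure then carries the affine formula
  -- to the boundary.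
  have := isOpen_interior.is_const_of_fderiv_eq_zero (𝕜 := ℝ) (f := fun Y => φ Y - L Y)
    hB.isConnected_interior.isPreconnected
    (fun Y hY => ((hd Y hY).sub L.differentiableAt).differentiableWithinAt) ?_ hX hZ
  · simp only [ContinuousLinearMap.coe_coe]
    rw [← this]
    abel
  · intro Y hY
    rw [fderiv_fun_sub (hd Y hY) L.differentiableAt, L.fderiv, Pi.zero_apply, sub_eq_zero]
    refine ext_basisVec fun i => ?_
    ext a
    have hF := h.deformationGradient_eq hB hY hZ
    rw [deformationGradient_of_mem_interior φ hY, deformationGradient_of_mem_interior φ hZ] at hF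
    exact congrFun (congrFun hF a) i

end Homogeneous

/-! ### Homogeneous deformations and the vanishing residual stress form universal pairs -/

section Converse

variable {B : Set E3} {φ : E3 → E3} {S : E3 → Tensor2}

theorem isResidualStress_of_eq_zero (hB : IsBody B) (hS : ∀ X ∈ B, S X = 0) :
    IsResidualStress B S where
  smooth a b := (contDiffOn_const (c := (0 : ℝ))).congr fun X hX => by simp [hS X hX]
  symm X hX := by simp [hS X hX]
  div_eq_zero X hX a := by
    rw [tensorDiv_eq_sum_pd]
    refine Finset.sum_eq_zero fun b _ => ?_
    exact pd_eq_zero_of_const isOpen_interior (k := 0)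
      (fun Y hY => by simp [hS Y (interior_subset hY)]) b X hX
  traction_free p hp N _ := by simp [hS p (hB.isClosed.frontier_subset hp)]

theorem IsHomogeneousDeformation.deformationGradient_eq (h : IsHomogeneousDeformation B φ)
    {X Z : E3} (hX : X ∈ interior B) (hZ : Z ∈ interior B) :
    deformationGradient B φ X = deformationGradient B φ Z := by
  obtain ⟨A, c, hA⟩ := h
  have key : ∀ Y ∈ interior B, fderiv ℝ φ Y = LinearMap.toContinuousLinearMap A := by
    intro Y hY
    have : φ =ᶠ[𝓝 Y] fun Y => LinearMap.toContinuousLinearMap A Y + c := by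
      filter_upwards [isOpen_interior.mem_nhds hY] with W hW
      exact hA W (interior_subset hW)
    rw [this.fderiv_eq, fderiv_add_const]
    exact (LinearMap.toContinuousLinearMap A).fderiv
  rw [deformationGradient_of_mem_interior φ hX, deformationGradient_of_mem_interior φ hZ,
    key X hX, key Z hZ]

theorem IsHomogeneousDeformation.isUniversalPair (hB : IsBody B) (hφ : IsDeformation B φ)
    (h : IsHomogeneousDeformation B φ) (hS : ∀ X ∈ B, S X = 0) : IsUniversalPair B φ S where
  isDeformation := hφ
  isResidualStress := isResidualStress_of_eq_zero hB hS
  equilibrium α _ x hx a := by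
    obtain ⟨Z, hZ⟩ := hB.isConnected_interior.nonempty
    rw [tensorDiv_eq_sum_pd]
    refine Finset.sum_eq_zero fun b _ => ?_
    refine pd_eq_zero_of_const hφ.isOpen_image
      (k := stressFunction α (leftCauchyGreen B φ Z) 0 a b) ?_ b x hx
    rintro _ ⟨Y, hY, rfl⟩
    rw [hφ.cauchyStress_apply (interior_subset hY)]
    simp [leftCauchyGreen, pushedResidualStress, h.deformationGradient_eq hY hZ,
      hS Y (interior_subset hY)]

theorem isDeformation_id (hB : IsBody B) : IsDeformation B id where
  smooth := contDiffOn_id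
  injOn := Set.injOn_id B
  det_ne_zero X hX := by
    have : deformationGradient B id X = 1 := by
      ext a A
      simp [deformationGradient, fderivWithin_id (hB.uniqueDiffOn X hX), basisVec,
        Matrix.one_apply]
    simp [this]

theorem isHomogeneousDeformation_id : IsHomogeneousDeformation B id :=
  ⟨LinearMap.id, 0, fun X _ => by simp⟩

end Converse

/-! ### The mean value of a tangential divergence-free field -/

section Cutoff

/-- The piecewise linear function that is `0` on `t ≤ ε` and `1` on `2 ε ≤ t`. -/
noncomputable def ramp (ε t : ℝ) : ℝ := max 0 (min 1 (t / ε - 1))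

theorem ramp_nonneg (ε t : ℝ) : 0 ≤ ramp ε t := le_max_left _ _

theorem ramp_le_one (ε t : ℝ) : ramp ε t ≤ 1 := max_le zero_le_one (min_le_left _ _)

theorem ramp_eq_zero {ε t : ℝ} (hε : 0 < ε) (h : t ≤ ε) : ramp ε t = 0 := by
  refine max_eq_left ((min_le_right _ _).trans ?_)
  rw [sub_nonpos, div_le_one hε]
  exact h

theorem ramp_eq_one {ε t : ℝ} (hε : 0 < ε) (h : 2 * ε ≤ t) : ramp ε t = 1 := by
  have : 2 ≤ t / ε := (le_div_iff₀ hε).2 h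
  rw [ramp, min_eq_left (by linarith), max_eq_right zero_le_one]

theorem abs_ramp_sub_le {ε : ℝ} (hε : 0 < ε) (s t : ℝ) :
    |ramp ε s - ramp ε t| ≤ ε⁻¹ * |s - t| := by
  have h1 : |ramp ε s - ramp ε t| ≤ |(s / ε - 1) - (t / ε - 1)| := by
    unfold ramp
    refine (abs_max_sub_max_le_max _ _ _ _).trans ?_
    rw [sub_self, abs_zero, max_eq_right (abs_nonneg _)]
    refine (abs_min_sub_min_le_max _ _ _ _).trans ?_
    rw [sub_self, abs_zero, max_eq_right (abs_nonneg _)]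
  refine h1.trans (le_of_eq ?_)
  rw [sub_sub_sub_cancel_right, ← sub_div, abs_div, abs_of_pos hε, div_eq_inv_mul]

end Cutoff

/-! ### Gradients of cutoffs and of distance functions -/

section Derivatives

variable {E : Type*} [NormedAddCommGroup E] [NormedSpace ℝ E]

/-- Pass to the limit in difference quotients. Applied to `ramp` of the distance, this replaces a
chain rule, which would fail at the corners of `ramp`. -/
theorem abs_fderiv_le_of_abs_sub_le {f k : E → ℝ} {x : E} {C : ℝ} (hf : DifferentiableAt ℝ f x)
    (hk : DifferentiableAt ℝ k x) (h : ∀ z, |f z - f x| ≤ C * |k z - k x|) (w : E) :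
    |fderiv ℝ f x w| ≤ C * |fderiv ℝ k x w| := by
  have hf' := (hf.hasFDerivAt.hasLineDerivAt w).tendsto_slope_zero
  have hk' := (hk.hasFDerivAt.hasLineDerivAt w).tendsto_slope_zero
  refine le_of_tendsto_of_tendsto hf'.abs (hk'.abs.const_mul C) (Filter.Eventually.of_forall ?_)
  intro t
  simp only [smul_eq_mul, abs_mul]
  have := mul_le_mul_of_nonneg_left (h (x + t • w)) (abs_nonneg t⁻¹)
  linarith

/-- Where the distance to a set is differentiable, its gradient points away from any nearest
point. -/
theorem infDist_mul_fderiv {E : Type*} [NormedAddCommGroup E] [InnerProductSpace ℝ E]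
    {s : Set E} {x y : E} (hy : y ∈ s)
    (hxy : Metric.infDist x s = dist x y)
    (hd : DifferentiableAt ℝ (fun z => Metric.infDist z s) x) (w : E) :
    Metric.infDist x s * fderiv ℝ (fun z => Metric.infDist z s) x w = inner ℝ (x - y) w := by
  have hmin : IsLocalMin (fun z => ‖z - y‖ ^ 2 - Metric.infDist z s ^ 2) x := by
    refine Filter.Eventually.of_forall fun z => ?_
    have h1 : Metric.infDist z s ≤ ‖z - y‖ := by
      rw [← dist_eq_norm]; exact Metric.infDist_le_dist_of_mem hy
    have h2 := pow_le_pow_left₀ Metric.infDist_nonneg h1 2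
    simp only
    rw [hxy, dist_eq_norm]
    linarith
  have h1 : HasFDerivAt (fun z => ‖z - y‖ ^ 2)
      (2 • (innerSL ℝ (x - y)).comp (ContinuousLinearMap.id ℝ E)) x :=
    ((hasFDerivAt_id x).sub_const y).norm_sq
  have h := hmin.hasFDerivAt_eq_zero (h1.sub (hd.hasFDerivAt.pow 2))
  have := congrArg (fun l : E →L[ℝ] ℝ => l w) h
  simp at this
  rw [inner_sub_left]
  linarith

end Derivatives

section MeanValue

open MeasureTheory

variable {Ω : Set E3} {v : Fin 3 → E3 → ℝ} {L M : ℝ}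

/-- The ball about `x` with radius its distance to the complement is convex and contained in `Ω`, so
the mean value inequality applies although `Ω` need not be convex. -/
theorem abs_sub_le_of_mem_ball (hΩ : ∀ b, ∀ x ∈ Ω, DifferentiableAt ℝ (v b) x)
    (hL : ∀ b, ∀ x ∈ Ω, ‖fderiv ℝ (v b) x‖ ≤ L) (b : Fin 3) {x z : E3}
    (hz : dist x z < Metric.infDist x Ωᶜ) : |v b x - v b z| ≤ L * dist x z := by
  have hsub := Metric.ball_infDist_compl_subset (s := Ω) (x := x)
  have hz' : z ∈ Metric.ball x (Metric.infDist x Ωᶜ) := by rwa [Metric.mem_ball']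
  have hx' : x ∈ Metric.ball x (Metric.infDist x Ωᶜ) :=
    Metric.mem_ball_self (dist_nonneg.trans_lt hz)
  have := (convex_ball x _).norm_image_sub_le_of_norm_fderiv_le (f := v b) (𝕜 := ℝ) (C := L)
    (fun y hy => hΩ b y (hsub hy)) (fun y hy => hL b y (hsub hy)) hz' hx'
  rwa [← dist_eq_norm x z] at this

/-- The cutoff removes the uncontrolled values of `v` outside `Ω`, giving a globally Lipschitz
function fit for integration by parts. For points closer than `ε` the product rule gives `L + M
ε⁻¹`; for other pairs the crude bound `2 M` is at most `2 M ε⁻¹` times the distance. -/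
theorem lipschitz_ramp_mul (hΩ : ∀ b, ∀ x ∈ Ω, DifferentiableAt ℝ (v b) x)
    (hL : ∀ b, ∀ x ∈ Ω, ‖fderiv ℝ (v b) x‖ ≤ L) (hM : ∀ b, ∀ x ∈ Ω, |v b x| ≤ M)
    (hL0 : 0 ≤ L) (hM0 : 0 ≤ M) {ε : ℝ} (hε : 0 < ε) (b : Fin 3) :
    LipschitzWith (L + 2 * M * ε⁻¹).toNNReal
      (fun x => ramp ε (Metric.infDist x Ωᶜ) * v b x) := by
  set d := fun x => Metric.infDist x Ωᶜ with hd
  have hK : 0 ≤ L + 2 * M * ε⁻¹ := by positivity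
  have hmem : ∀ x, ε < d x → x ∈ Ω := fun x hx => by
    by_contra hcon
    have : d x = 0 := Metric.infDist_zero_of_mem hcon
    linarith
  have hbound : ∀ x, |ramp ε (d x) * v b x| ≤ M := by
    intro x
    rcases le_or_gt (d x) ε with h | h
    · simpa [ramp_eq_zero hε h] using hM0
    · rw [abs_mul, abs_of_nonneg (ramp_nonneg _ _)]
      exact (mul_le_of_le_one_left (abs_nonneg _) (ramp_le_one _ _)).trans (hM b x (hmem x h))
  have hd1 : ∀ x z, |d x - d z| ≤ dist x z := fun x z => by
    have := (Metric.lipschitz_infDist_pt Ωᶜ).dist_le_mul x z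
    simpa [Real.dist_eq] using this
  have key : ∀ x z, ε < d x →
      |ramp ε (d x) * v b x - ramp ε (d z) * v b z| ≤ (L + 2 * M * ε⁻¹) * dist x z := by
    intro x z hx
    rcases lt_or_ge (dist x z) ε with h | h
    · have hzΩ : z ∈ Ω := Metric.ball_infDist_compl_subset (x := x)
        (by rw [Metric.mem_ball']; exact h.trans hx)
      have e : ramp ε (d x) * v b x - ramp ε (d z) * v b z
          = ramp ε (d x) * (v b x - v b z) + (ramp ε (d x) - ramp ε (d z)) * v b z := by ring
      have h1 : |ramp ε (d x) * (v b x - v b z)| ≤ L * dist x z := by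
        rw [abs_mul, abs_of_nonneg (ramp_nonneg _ _)]
        exact (mul_le_of_le_one_left (abs_nonneg _) (ramp_le_one _ _)).trans
          (abs_sub_le_of_mem_ball hΩ hL b (h.trans hx))
      have h2 : |(ramp ε (d x) - ramp ε (d z)) * v b z| ≤ ε⁻¹ * dist x z * M := by
        rw [abs_mul]
        have := (abs_ramp_sub_le hε (d x) (d z)).trans
          (mul_le_mul_of_nonneg_left (hd1 x z) (inv_pos.2 hε).le)
        exact mul_le_mul this (hM b z hzΩ) (abs_nonneg _) (by positivity)
      rw [e]
      refine (abs_add_le _ _).trans ((add_le_add h1 h2).trans ?_)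
      have : 0 ≤ ε⁻¹ * dist x z * M := by positivity
      linarith
    · have h1 : 1 ≤ ε⁻¹ * dist x z := by
        rw [inv_mul_eq_div, le_div_iff₀ hε, one_mul]; exact h
      have h2 := abs_sub (ramp ε (d x) * v b x) (ramp ε (d z) * v b z)
      have h3 := hbound x
      have h4 := hbound z
      have h5 := mul_le_mul_of_nonneg_left h1 hM0
      have h6 : 0 ≤ L * dist x z := by positivity
      linarith
  refine LipschitzWith.of_dist_le_mul fun x z => ?_
  rw [Real.coe_toNNReal _ hK, Real.dist_eq]
  rcases lt_or_ge ε (d x) with hx | hx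
  · exact key x z hx
  · rcases lt_or_ge ε (d z) with hz | hz
    · rw [abs_sub_comm, dist_comm]
      exact key z x hz
    · change |ramp ε (d x) * v b x - ramp ε (d z) * v b z| ≤ _
      rw [ramp_eq_zero hε hx, ramp_eq_zero hε hz]
      simp only [zero_mul, sub_self, abs_zero]
      positivity

/-- The gradient of the distance is along `x - y` for a nearest point `y`, and `v y` is orthogonal
to that direction. Only `v x - v y` contributes, each of its three components being at most `L`
times the distance. -/
theorem abs_sum_fderiv_infDist_mul_le (hΩ : ∀ b, ∀ x ∈ Ω, DifferentiableAt ℝ (v b) x)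
    (hL : ∀ b, ∀ x ∈ Ω, ‖fderiv ℝ (v b) x‖ ≤ L)
    (hopen : IsOpen Ω) (hne : Ωᶜ.Nonempty)
    (hcont : ∀ b, ContinuousOn (v b) (closure Ω))
    (htan : ∀ x ∈ Ω, ∀ y ∈ frontier Ω, Metric.infDist x Ωᶜ = dist x y →
      ∑ b, v b y * (x - y) b = 0)
    {x : E3} (hx : x ∈ Ω) (hd : DifferentiableAt ℝ (fun z => Metric.infDist z Ωᶜ) x) :
    |fderiv ℝ (fun z => Metric.infDist z Ωᶜ) x (WithLp.toLp 2 fun b => v b x)|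
      ≤ 3 * L * Metric.infDist x Ωᶜ := by
  obtain ⟨y, hy, hxy⟩ := hopen.isClosed_compl.exists_infDist_eq_dist hne x
  have hpos : 0 < Metric.infDist x Ωᶜ :=
    (hopen.isClosed_compl.notMem_iff_infDist_pos hne).1 (by simpa using hx)
  set w : E3 := WithLp.toLp 2 fun b => v b x with hw
  have hmemball : ∀ t ∈ Set.Ico (0 : ℝ) 1,
      dist x (x + t • (y - x)) < Metric.infDist x Ωᶜ := by
    intro t ht
    rw [dist_self_add_right, norm_smul, Real.norm_of_nonneg ht.1, ← dist_eq_norm, dist_comm y,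
      ← hxy]
    exact mul_lt_of_lt_one_left hpos ht.2
  -- The estimate `abs_sub_le_of_mem_ball` needs points strictly inside the ball, so `y` is
  -- approached along the segment from `x` and continuity on `closure Ω` supplies the limit.
  have hpath : Filter.Tendsto (fun t : ℝ => x + t • (y - x)) (𝓝[<] 1) (𝓝[Ω] y) := by
    refine tendsto_nhdsWithin_iff.2 ⟨?_, ?_⟩
    · have : ContinuousAt (fun t : ℝ => x + t • (y - x)) 1 := by fun_prop
      have h := this.tendsto.mono_left (nhdsWithin_le_nhds (s := Set.Iio 1))
      simpa using h
    · filter_upwards [Ico_mem_nhdsLT (zero_lt_one (α := ℝ))] with t ht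
      exact Metric.ball_infDist_compl_subset (x := x)
        (by rw [Metric.mem_ball']; exact hmemball t ht)
  have hyc : y ∈ closure Ω := by
    rw [mem_closure_iff_nhdsWithin_neBot]
    exact hpath.neBot
  have hyf : y ∈ frontier Ω := ⟨hyc, by rwa [hopen.interior_eq]⟩
  have hdiff : ∀ b, |v b x - v b y| ≤ L * Metric.infDist x Ωᶜ := by
    intro b
    have h1 : Filter.Tendsto (fun t : ℝ => |v b x - v b (x + t • (y - x))|) (𝓝[<] 1)
        (𝓝 |v b x - v b y|) :=
      (tendsto_const_nhds.sub (((hcont b y hyc).tendsto.mono_left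
        (nhdsWithin_mono _ subset_closure)).comp hpath)).abs
    refine le_of_tendsto h1 ?_
    filter_upwards [Ico_mem_nhdsLT (zero_lt_one (α := ℝ))] with t ht
    have hL0 : 0 ≤ L := (norm_nonneg _).trans (hL b x hx)
    exact (abs_sub_le_of_mem_ball hΩ hL b (hmemball t ht)).trans
      (mul_le_mul_of_nonneg_left (hmemball t ht).le hL0)
  have hgrad := infDist_mul_fderiv hy hxy hd w
  have hinner : inner ℝ (x - y) w = ∑ b, (v b x - v b y) * (x - y) b := by
    rw [PiLp.inner_apply]
    simp only [sub_mul, Finset.sum_sub_distrib, htan x hx y hyf hxy, sub_zero]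
    simp [hw]
  have hcomp : ∀ b, |(x - y) b| ≤ Metric.infDist x Ωᶜ := fun b => by
    rw [hxy, dist_eq_norm]
    exact PiLp.norm_apply_le (x - y) b
  have habs : |inner ℝ (x - y) w| ≤ 3 * L * Metric.infDist x Ωᶜ * Metric.infDist x Ωᶜ := by
    rw [hinner]
    refine (Finset.abs_sum_le_sum_abs _ _).trans ?_
    refine (Finset.sum_le_card_nsmul _ _ (L * Metric.infDist x Ωᶜ * Metric.infDist x Ωᶜ)
      fun b _ => ?_).trans (le_of_eq ?_)
    · rw [abs_mul]
      exact mul_le_mul (hdiff b) (hcomp b) (abs_nonneg _) ((abs_nonneg _).trans (hdiff b))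
    · simp
      ring
  rw [← hgrad, abs_mul, abs_of_pos hpos, mul_comm] at habs
  exact le_of_mul_le_mul_right habs hpos

end MeanValue
section MeanValue

open MeasureTheory

variable {Ω : Set E3} {v : Fin 3 → E3 → ℝ} {L M R : ℝ}

theorem integrable_lineDeriv_mul_coord {g : E3 → ℝ} {K : NNReal} (hg : LipschitzWith K g)
    (hsupp : ∀ x ∉ Metric.closedBall (0 : E3) R, g =ᶠ[𝓝 x] 0) (w : E3) (a : Fin 3) :
    Integrable (fun x : E3 => lineDeriv ℝ g x w * x a) := by
  have h1 : IntegrableOn (fun x : E3 => lineDeriv ℝ g x w * x a) (Metric.closedBall 0 R) :=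
    IntegrableOn.mul_continuousOn
      ((hg.locallyIntegrable_lineDeriv w).integrableOn_isCompact (isCompact_closedBall _ _))
      (by fun_prop) (isCompact_closedBall _ _)
  refine (integrableOn_iff_integrable_of_support_subset fun x hx => ?_).1 h1
  by_contra hcon
  refine hx ?_
  simp only
  rw [(hsupp x hcon).lineDeriv_eq]
  simp [lineDeriv]

/-- Since `v` is divergence-free, only its product with the cutoff gradient remains, and that lives
in the strip. There the slope `ε⁻¹` meets the bound `3 L · 2 ε`, which gives `6 L` independently of
`ε`. -/
theorem abs_sum_lineDeriv_ramp_mul_le (hΩ : ∀ b, ∀ x ∈ Ω, DifferentiableAt ℝ (v b) x)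
    (hL : ∀ b, ∀ x ∈ Ω, ‖fderiv ℝ (v b) x‖ ≤ L) (hL0 : 0 ≤ L)
    (hopen : IsOpen Ω) (hne : Ωᶜ.Nonempty)
    (hcont : ∀ b, ContinuousOn (v b) (closure Ω))
    (htan : ∀ x ∈ Ω, ∀ y ∈ frontier Ω, Metric.infDist x Ωᶜ = dist x y →
      ∑ b, v b y * (x - y) b = 0)
    (hdiv : ∀ x ∈ Ω, ∑ b, fderiv ℝ (v b) x (basisVec b) = 0)
    {ε : ℝ} (hε : 0 < ε) {x : E3}
    (hd : DifferentiableAt ℝ (fun z => Metric.infDist z Ωᶜ) x)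
    (hχ : DifferentiableAt ℝ (fun z => ramp ε (Metric.infDist z Ωᶜ)) x) :
    |∑ b, lineDeriv ℝ (fun z => ramp ε (Metric.infDist z Ωᶜ) * v b z) x (basisVec b)|
      ≤ (Ω ∩ {z | Metric.infDist z Ωᶜ ≤ 2 * ε}).indicator (fun _ => 6 * L) x := by
  have hdc : Continuous fun z => Metric.infDist z Ωᶜ := Metric.continuous_infDist_pt _
  by_cases hx : x ∈ Ω
  · rcases le_or_gt (Metric.infDist x Ωᶜ) (2 * ε) with h | h
    · rw [Set.indicator_of_mem (s := Ω ∩ {z | Metric.infDist z Ωᶜ ≤ 2 * ε}) ⟨hx, h⟩]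
      have e : ∀ b, lineDeriv ℝ (fun z => ramp ε (Metric.infDist z Ωᶜ) * v b z) x (basisVec b)
          = ramp ε (Metric.infDist x Ωᶜ) * fderiv ℝ (v b) x (basisVec b)
            + fderiv ℝ (fun z => ramp ε (Metric.infDist z Ωᶜ)) x (basisVec b) * v b x := by
        intro b
        rw [(hχ.fun_mul (hΩ b x hx)).lineDeriv_eq_fderiv, fderiv_fun_mul hχ (hΩ b x hx)]
        simp [mul_comm]
      have hw := clm_apply_eq_sum (fderiv ℝ (fun z => ramp ε (Metric.infDist z Ωᶜ)) x)
        (WithLp.toLp 2 fun b => v b x)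
      simp only at hw
      simp only [e]
      rw [Finset.sum_add_distrib, ← Finset.mul_sum, hdiv x hx, mul_zero, zero_add, ← hw]
      have h1 := abs_fderiv_le_of_abs_sub_le hχ hd
        (fun z => abs_ramp_sub_le hε (Metric.infDist z Ωᶜ) (Metric.infDist x Ωᶜ))
        (WithLp.toLp 2 fun b => v b x)
      have h2 := abs_sum_fderiv_infDist_mul_le hΩ hL hopen hne hcont htan hx hd
      have h3 : 3 * L * Metric.infDist x Ωᶜ ≤ 3 * L * (2 * ε) :=
        mul_le_mul_of_nonneg_left h (by positivity)
      have h4 := mul_le_mul_of_nonneg_left (h2.trans h3) (inv_pos.2 hε).le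
      refine h1.trans (h4.trans (le_of_eq ?_))
      field_simp
      ring
    · rw [Set.indicator_of_notMem (fun hcon => absurd hcon.2 (not_le.2 h))]
      have e : ∀ b, lineDeriv ℝ (fun z => ramp ε (Metric.infDist z Ωᶜ) * v b z) x (basisVec b)
          = fderiv ℝ (v b) x (basisVec b) := by
        intro b
        have : (fun z => ramp ε (Metric.infDist z Ωᶜ) * v b z) =ᶠ[𝓝 x] v b := by
          filter_upwards [hdc.continuousAt.eventually (lt_mem_nhds h)] with z hz
          rw [ramp_eq_one hε hz.le, one_mul]
        rw [this.lineDeriv_eq, (hΩ b x hx).lineDeriv_eq_fderiv]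
      simp only [e]
      rw [hdiv x hx, abs_zero]
  · rw [Set.indicator_of_notMem (fun hcon => hx hcon.1)]
    have h0 : Metric.infDist x Ωᶜ < ε := by
      rw [Metric.infDist_zero_of_mem hx]; exact hε
    have e : ∀ b,
        lineDeriv ℝ (fun z => ramp ε (Metric.infDist z Ωᶜ) * v b z) x (basisVec b) = 0 := by
      intro b
      have : (fun z => ramp ε (Metric.infDist z Ωᶜ) * v b z) =ᶠ[𝓝 x] fun _ => 0 := by
        filter_upwards [hdc.continuousAt.eventually (gt_mem_nhds h0)] with z hz
        rw [ramp_eq_zero hε hz.le, zero_mul]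
      rw [this.lineDeriv_eq]
      simp [lineDeriv]
    simp only [e]
    simp

/-- Integration by parts against the coordinate `x a` turns the integral of the `a`-th component
into that of `-x a` times the divergence of the cut-off field. The factor `R` bounds `x a`. -/
theorem abs_integral_ramp_mul_le (hΩ : ∀ b, ∀ x ∈ Ω, DifferentiableAt ℝ (v b) x)
    (hL : ∀ b, ∀ x ∈ Ω, ‖fderiv ℝ (v b) x‖ ≤ L) (hL0 : 0 ≤ L)
    (hM : ∀ b, ∀ x ∈ Ω, |v b x| ≤ M) (hM0 : 0 ≤ M)
    (hopen : IsOpen Ω) (hR : Ω ⊆ Metric.closedBall 0 R) (hne : Ωᶜ.Nonempty)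
    (hcont : ∀ b, ContinuousOn (v b) (closure Ω))
    (htan : ∀ x ∈ Ω, ∀ y ∈ frontier Ω, Metric.infDist x Ωᶜ = dist x y →
      ∑ b, v b y * (x - y) b = 0)
    (hdiv : ∀ x ∈ Ω, ∑ b, fderiv ℝ (v b) x (basisVec b) = 0)
    {ε : ℝ} (hε : 0 < ε) (a : Fin 3) :
    |∫ x in Ω, ramp ε (Metric.infDist x Ωᶜ) * v a x|
      ≤ ∫ x in Ω, {z | Metric.infDist z Ωᶜ ≤ 2 * ε}.indicator (fun _ => 6 * L * R) x := by
  set g : Fin 3 → E3 → ℝ := fun b x => ramp ε (Metric.infDist x Ωᶜ) * v b x with hgdef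
  have hg : ∀ b, LipschitzWith (L + 2 * M * ε⁻¹).toNNReal (g b) :=
    fun b => lipschitz_ramp_mul hΩ hL hM hL0 hM0 hε b
  have hg0 : ∀ b, ∀ x ∉ Ω, g b x = 0 := fun b x hx => by
    simp [hgdef, Metric.infDist_zero_of_mem (show x ∈ Ωᶜ from hx), ramp_eq_zero hε hε.le]
  have hgsupp : ∀ b, ∀ x ∉ Metric.closedBall (0 : E3) R, g b =ᶠ[𝓝 x] 0 := fun b x hx => by
    filter_upwards [Metric.isClosed_closedBall.isOpen_compl.mem_nhds hx] with z hz
    exact hg0 b z fun h => hz (hR h)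
  have hcomp : ∀ b, HasCompactSupport (g b) := fun b =>
    HasCompactSupport.intro (isCompact_closedBall (0 : E3) R) fun x hx => (hgsupp b x hx).eq_of_nhds
  have hproj : ∀ x : E3, ∀ b, lineDeriv ℝ (fun z : E3 => z a) x (basisVec b)
      = if a = b then 1 else 0 := by
    intro x b
    have : lineDeriv ℝ (fun z : E3 => z a) x (basisVec b)
        = EuclideanSpace.proj (𝕜 := ℝ) a (basisVec b) :=
      ((EuclideanSpace.proj (𝕜 := ℝ) a).hasFDerivAt.hasLineDerivAt (basisVec b)).lineDeriv
    rw [this]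
    simp [basisVec]
  have hlip : LipschitzWith ‖(EuclideanSpace.proj a : E3 →L[ℝ] ℝ)‖₊
      (fun z : E3 => z a) := (EuclideanSpace.proj (𝕜 := ℝ) a).lipschitz
  -- Rademacher-type integration by parts: both factors are Lipschitz and `g b` has compact support.
  have hparts : ∀ b, ∫ x, (if a = b then 1 else 0) * g b x
      = -∫ x, lineDeriv ℝ (g b) x (basisVec b) * x a := by
    intro b
    have := hlip.integral_lineDeriv_mul_eq (μ := volume) (hg b) (hcomp b) (basisVec b)
    simp only [hproj] at this
    rw [this, ← integral_neg]
    simp only [lineDeriv_neg, neg_mul]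
  have hsum : ∫ x, g a x = -∫ x, ∑ b, lineDeriv ℝ (g b) x (basisVec b) * x a := by
    rw [integral_finsetSum _ fun b _ => integrable_lineDeriv_mul_coord (hg b) (hgsupp b) _ a,
      ← Finset.sum_neg_distrib]
    simp only [← hparts]
    rw [Finset.sum_eq_single a]
    · simp
    · intro b _ hb
      simp [hb.symm]
    · simp
  have hset : MeasurableSet {z : E3 | Metric.infDist z Ωᶜ ≤ 2 * ε} :=
    (isClosed_le (Metric.continuous_infDist_pt _) continuous_const).measurableSet
  have hfin : volume (Ω ∩ {z : E3 | Metric.infDist z Ωᶜ ≤ 2 * ε}) ≠ ⊤ :=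
    ((measure_mono (Set.inter_subset_left.trans hR)).trans_lt measure_closedBall_lt_top).ne
  rw [setIntegral_eq_integral_of_forall_compl_eq_zero (hg0 a), hsum, abs_neg,
    integral_indicator hset, Measure.restrict_restrict hset, Set.inter_comm,
    ← integral_indicator (hopen.measurableSet.inter hset), ← Real.norm_eq_abs]
  refine norm_integral_le_of_norm_le
    ((integrable_indicator_iff (hopen.measurableSet.inter hset)).2 (integrableOn_const hfin)) ?_
  have hdlip : LipschitzWith 1 fun z : E3 => Metric.infDist z Ωᶜ :=
    Metric.lipschitz_infDist_pt _
  have hχlip : LipschitzWith (ε⁻¹).toNNReal fun z : E3 => ramp ε (Metric.infDist z Ωᶜ) := by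
    refine LipschitzWith.of_dist_le_mul fun x z => ?_
    rw [Real.coe_toNNReal _ (inv_pos.2 hε).le, Real.dist_eq]
    refine (abs_ramp_sub_le hε _ _).trans (mul_le_mul_of_nonneg_left ?_ (inv_pos.2 hε).le)
    simpa [Real.dist_eq] using hdlip.dist_le_mul x z
  filter_upwards [hdlip.ae_differentiableAt (μ := volume),
    hχlip.ae_differentiableAt (μ := volume)] with x hdx hχx
  have hle := abs_sum_lineDeriv_ramp_mul_le hΩ hL hL0 hopen hne hcont htan hdiv hε hdx hχx
  rw [← Finset.sum_mul, Real.norm_eq_abs, abs_mul]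
  by_cases hx : x ∈ Ω ∩ {z | Metric.infDist z Ωᶜ ≤ 2 * ε}
  · rw [Set.indicator_of_mem hx] at hle ⊢
    have hxa : |x a| ≤ R := by
      refine (PiLp.norm_apply_le x a).trans ?_
      simpa using hR hx.1
    exact mul_le_mul hle hxa (abs_nonneg _) (by positivity)
  · rw [Set.indicator_of_notMem hx] at hle ⊢
    exact mul_nonpos_of_nonpos_of_nonneg hle (abs_nonneg _)

/-- A divergence-free field on a bounded open set which is orthogonal to the boundary normals
has zero mean. -/
theorem setIntegral_eq_zero_of_div_eq_zero (hΩ : ∀ b, ∀ x ∈ Ω, DifferentiableAt ℝ (v b) x)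
    (hL : ∀ b, ∀ x ∈ Ω, ‖fderiv ℝ (v b) x‖ ≤ L) (hL0 : 0 ≤ L)
    (hM : ∀ b, ∀ x ∈ Ω, |v b x| ≤ M) (hM0 : 0 ≤ M)
    (hopen : IsOpen Ω) (hR : Ω ⊆ Metric.closedBall 0 R)
    (hcont : ∀ b, ContinuousOn (v b) (closure Ω))
    (htan : ∀ x ∈ Ω, ∀ y ∈ frontier Ω, Metric.infDist x Ωᶜ = dist x y →
      ∑ b, v b y * (x - y) b = 0)
    (hdiv : ∀ x ∈ Ω, ∑ b, fderiv ℝ (v b) x (basisVec b) = 0) (a : Fin 3) :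
    ∫ x in Ω, v a x = 0 := by
  have hne : Ωᶜ.Nonempty := by
    rw [Set.nonempty_compl]
    rintro rfl
    exact NormedSpace.unbounded_univ ℝ E3 (Metric.isBounded_closedBall.subset hR)
  have hfinΩ : volume Ω ≠ ⊤ := ((measure_mono hR).trans_lt measure_closedBall_lt_top).ne
  have : IsFiniteMeasure (volume.restrict Ω) := ⟨by simpa using hfinΩ.lt_top⟩
  have hpos : ∀ x ∈ Ω, 0 < Metric.infDist x Ωᶜ := fun x hx =>
    (hopen.isClosed_compl.notMem_iff_infDist_pos hne).1 (by simpa using hx)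
  have hdc : Continuous fun z => Metric.infDist z Ωᶜ := Metric.continuous_infDist_pt _
  have hε : ∀ n : ℕ, 0 < 1 / ((n : ℝ) + 1) := fun n => Nat.one_div_pos_of_nat
  have hsmall : ∀ x ∈ Ω, ∀ᶠ n : ℕ in Filter.atTop,
      2 * (1 / ((n : ℝ) + 1)) < Metric.infDist x Ωᶜ := by
    intro x hx
    have h := (tendsto_one_div_add_atTop_nhds_zero_nat (𝕜 := ℝ)).const_mul 2
    rw [mul_zero] at h
    exact h.eventually (gt_mem_nhds (hpos x hx))
  have hlim1 : Filter.Tendsto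
      (fun n : ℕ => ∫ x in Ω, ramp (1 / ((n : ℝ) + 1)) (Metric.infDist x Ωᶜ) * v a x)
      Filter.atTop (𝓝 (∫ x in Ω, v a x)) := by
    refine tendsto_integral_of_dominated_convergence (fun _ => M) ?_ (integrable_const _) ?_ ?_
    · intro n
      exact (lipschitz_ramp_mul hΩ hL hM hL0 hM0 (hε n) a).continuous.aestronglyMeasurable
    · intro n
      filter_upwards [ae_restrict_mem hopen.measurableSet] with x hx
      rw [Real.norm_eq_abs, abs_mul, abs_of_nonneg (ramp_nonneg _ _)]
      exact (mul_le_of_le_one_left (abs_nonneg _) (ramp_le_one _ _)).trans (hM a x hx)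
    · filter_upwards [ae_restrict_mem hopen.measurableSet] with x hx
      refine tendsto_const_nhds.congr' ?_
      filter_upwards [hsmall x hx] with n hn
      rw [ramp_eq_one (hε n) hn.le, one_mul]
  -- Every point of the open set `Ω` has positive distance to the complement and eventually leaves
  -- the shrinking strips.
  have hlim2 : Filter.Tendsto
      (fun n : ℕ => ∫ x in Ω, {z | Metric.infDist z Ωᶜ ≤ 2 * (1 / ((n : ℝ) + 1))}.indicator
        (fun _ => 6 * L * R) x)
      Filter.atTop (𝓝 (∫ x in Ω, (0 : ℝ))) := by
    refine tendsto_integral_of_dominated_convergence (fun _ => |6 * L * R|) ?_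
      (integrable_const _) ?_ ?_
    · intro n
      exact (measurable_const.indicator
        (isClosed_le hdc continuous_const).measurableSet).aestronglyMeasurable
    · intro n
      exact Filter.Eventually.of_forall fun x => norm_indicator_le_norm_self _ _
    · filter_upwards [ae_restrict_mem hopen.measurableSet] with x hx
      refine tendsto_const_nhds.congr' ?_
      filter_upwards [hsmall x hx] with n hn
      exact (Set.indicator_of_notMem (s := {z | Metric.infDist z Ωᶜ ≤ 2 * (1 / ((n : ℝ) + 1))})
        (fun hcon => absurd hn (not_lt.2 hcon)) _).symm
  rw [integral_zero] at hlim2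
  have := le_of_tendsto_of_tendsto' hlim1.abs hlim2 fun n =>
    abs_integral_ramp_mul_le hΩ hL hL0 hM hM0 hopen hR hne hcont htan hdiv (hε n) a
  exact abs_nonpos_iff.1 this

end MeanValue
/-! ### Normals and interior balls -/

/-- The centre of a ball inside `B` touching the boundary at `y` lies on the normal line. -/
theorem IsLocalDefiningFunction.exists_eq_smul {B : Set E3} {x y : E3} {ρ : E3 → ℝ}
    (hρ : IsLocalDefiningFunction B y ρ) (hball : Metric.ball x (dist x y) ⊆ B) :
    ∃ k : ℝ, x - y = k • gradient ρ y := by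
  obtain ⟨hs, hρy, hg, hiff⟩ := hρ
  set g := gradient ρ y with hgdef
  set u := x - y with hu
  have hgpos : 0 < ‖g‖ := norm_pos_iff.2 hg
  -- The bisector direction of `u` and `g`. If it is nonzero, it makes an acute angle with both, so
  -- a small step from `y` along `w` enters the ball, hence `B`, while `ρ` becomes positive. If it
  -- is zero, `u` is a multiple of `g`.
  set w := ‖g‖ • u + ‖u‖ • g with hw
  by_cases hw0 : w = 0
  · refine ⟨-(‖g‖⁻¹ * ‖u‖), ?_⟩
    have : ‖g‖ • u = -(‖u‖ • g) := eq_neg_of_add_eq_zero_left hw0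
    rw [neg_smul, mul_smul, ← smul_neg, ← this, inv_smul_smul₀ hgpos.ne']
  · exfalso
    have hwu : inner ℝ u w = ‖u‖ * (‖g‖ * ‖u‖ + inner ℝ g u) := by
      rw [hw, inner_add_right, inner_smul_right, inner_smul_right, real_inner_self_eq_norm_sq,
        real_inner_comm g u]
      ring
    have hwg : inner ℝ g w = ‖g‖ * (‖g‖ * ‖u‖ + inner ℝ g u) := by
      rw [hw, inner_add_right, inner_smul_right, inner_smul_right, real_inner_self_eq_norm_sq]
      ring
    have hww : ‖w‖ ^ 2 = 2 * ‖g‖ * (‖u‖ * (‖g‖ * ‖u‖ + inner ℝ g u)) := by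
      rw [← real_inner_self_eq_norm_sq w]
      conv_lhs => rw [hw]
      rw [← hw, inner_add_left, inner_smul_left, inner_smul_left, hwu, hwg]
      simp
      ring
    have hwpos : 0 < ‖w‖ ^ 2 := by positivity
    have hupos : 0 < inner ℝ u w := by
      rw [hww, ← hwu] at hwpos
      exact pos_of_mul_pos_right hwpos (by positivity)
    have hgw : 0 < inner ℝ g w := by
      rw [hwg]
      rw [hwu] at hupos
      exact mul_pos hgpos (pos_of_mul_pos_right hupos (norm_nonneg _))
    have hgrad : HasGradientAt ρ g y := (hs.contDiffAt.differentiableAt (by simp)).hasGradientAt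
    have hline := (hgrad.hasFDerivAt.hasLineDerivAt w).tendsto_slope_zero_right
    simp only [InnerProductSpace.toDual_apply_apply, hρy, sub_zero, smul_eq_mul] at hline
    have hpath : Filter.Tendsto (fun t : ℝ => y + t • w) (𝓝[>] 0) (𝓝 y) := by
      have : ContinuousAt (fun t : ℝ => y + t • w) 0 := by fun_prop
      have h := this.tendsto.mono_left (nhdsWithin_le_nhds (s := Set.Ioi 0))
      simpa using h
    have hsmall : ∀ᶠ t : ℝ in 𝓝[>] 0, t * ‖w‖ ^ 2 < 2 * inner ℝ u w := by
      have : ContinuousAt (fun t : ℝ => t * ‖w‖ ^ 2) 0 := by fun_prop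
      have h := this.tendsto.mono_left (nhdsWithin_le_nhds (s := Set.Ioi 0))
      exact h.eventually (gt_mem_nhds (by simpa using hupos))
    obtain ⟨t, ⟨⟨⟨h1, h2⟩, h3⟩, h4⟩⟩ := (((hline.eventually (lt_mem_nhds hgw)).and
      (hpath.eventually hiff)).and hsmall).and self_mem_nhdsWithin |>.exists
    have ht : 0 < t := h4
    have hmem : y + t • w ∈ B := by
      refine hball ?_
      rw [Metric.mem_ball', dist_eq_norm, dist_eq_norm, ← hu]
      have e : x - (y + t • w) = u - t • w := by rw [hu]; abel
      rw [e]
      refine lt_of_pow_lt_pow_left₀ 2 (norm_nonneg _) ?_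
      rw [norm_sub_sq_real, inner_smul_right, norm_smul, Real.norm_of_nonneg ht.le]
      nlinarith
    have := h2.1 hmem
    have h5 := pos_of_mul_pos_right h1 (inv_pos.2 ht).le
    linarith

/-- An interior ball touching the boundary at `y` has its centre on the normal line, so the traction
condition also annihilates `x - y`. This is the form of tangency needed at nearest boundary points.
-/
theorem IsResidualStress.mulVec_sub_eq_zero {B : Set E3} {S : E3 → Tensor2} (hB : IsBody B)
    (hS : IsResidualStress B S) {x y : E3} (hy : y ∈ frontier B)
    (hball : Metric.ball x (dist x y) ⊆ B) : S y *ᵥ (fun i => (x - y) i) = 0 := by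
  obtain ⟨ρ, hρ⟩ := hB.smooth_boundary y hy
  obtain ⟨k, hk⟩ := hρ.exists_eq_smul hball
  have h := hS.traction_free y hy _ ⟨ρ, hρ, rfl⟩
  have hg : ‖gradient ρ y‖ ≠ 0 := norm_ne_zero_iff.2 hρ.2.2.1
  have e : (fun i => (x - y) i)
      = (k * ‖gradient ρ y‖) • fun i => (‖gradient ρ y‖⁻¹ • gradient ρ y) i := by
    funext i
    rw [hk]
    simp only [PiLp.smul_apply, Pi.smul_apply, smul_eq_mul]
    field_simp
  rw [e, Matrix.mulVec_smul, h, smul_zero]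

/-! ### Divergence under homogeneous deformations -/

section Pullback

variable {B : Set E3} {φ : E3 → E3}

theorem IsDeformation.pd_comp_invFunOn (hφ : IsDeformation B φ) {f : E3 → ℝ} {X : E3}
    (hX : X ∈ interior B) (hf : DifferentiableAt ℝ f X) (b : Fin 3) :
    pd b (fun y => f (Function.invFunOn φ B y)) (φ X)
      = ∑ D, pd D f X * inverseGradient B φ (φ X) D b := by
  have hY : DifferentiableAt ℝ (Function.invFunOn φ B) (φ X) :=
    differentiableAt_of_smoothOn hφ.isOpen_image hφ.contDiffOn_invFunOn
      (Set.mem_image_of_mem φ hX)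
  have hinv := hφ.invFunOn_apply (interior_subset hX)
  have hf' : DifferentiableAt ℝ f (Function.invFunOn φ B (φ X)) := by rwa [hinv]
  have h1 : pd b (fun y => f (Function.invFunOn φ B y)) (φ X)
      = fderiv ℝ f X (fderiv ℝ (Function.invFunOn φ B) (φ X) (basisVec b)) := by
    unfold pd
    have := fderiv_comp (φ X) hf' hY
    rw [hinv] at this
    exact congrArg (fun l : E3 →L[ℝ] ℝ => l (basisVec b)) this
  rw [h1, clm_apply_eq_sum]
  refine Finset.sum_congr rfl fun D _ => ?_
  congr 1
  have h2 := ((EuclideanSpace.proj (𝕜 := ℝ) D).hasFDerivAt.comp (φ X) hY.hasFDerivAt).fderiv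
  exact (congrArg (fun l : E3 →L[ℝ] ℝ => l (basisVec b)) h2).symm

/-- For constant `F` the chain rule brings in the gradient of the inverse motion, which cancels
against the factor `Fᵀ`; the other `F` passes through the derivative. -/
theorem IsDeformation.tensorDiv_pushforward (hφ : IsDeformation B φ) {F : Tensor2}
    (hF : ∀ X ∈ interior B, deformationGradient B φ X = F) {T σ : E3 → Tensor2}
    (hT : ∀ A C, ContDiffOn ℝ ∞ (fun X => T X A C) (interior B))
    (hσ : ∀ X ∈ interior B, σ (φ X) = F * T X * Fᵀ) {X : E3} (hX : X ∈ interior B) :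
    tensorDiv σ (φ X) = F *ᵥ tensorDiv T X := by
  have hU := hφ.isOpen_image
  have hx := Set.mem_image_of_mem φ hX
  have ht : ∀ A C, ContDiffOn ℝ ∞ (fun y => T (Function.invFunOn φ B y) A C)
      (φ '' interior B) := by
    intro A C
    refine (hT A C).comp hφ.contDiffOn_invFunOn ?_
    rintro _ ⟨Z, hZ, rfl⟩
    simpa [hφ.invFunOn_apply (interior_subset hZ)] using hZ
  have hPF := hφ.inverseGradient_mul hX
  rw [hF X hX] at hPF
  funext a
  have h1 : ∀ b, pd b (fun y => σ y a b) (φ X) = ∑ A, F a A * ∑ C, F b C *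
      pd b (fun y => T (Function.invFunOn φ B y) A C) (φ X) := by
    intro b
    have e : Set.EqOn (fun y => σ y a b)
        (fun y => ∑ A, F a A * ∑ C, F b C * T (Function.invFunOn φ B y) A C)
        (φ '' interior B) := by
      rintro _ ⟨Z, hZ, rfl⟩
      simp only [hσ Z hZ, hφ.invFunOn_apply (interior_subset hZ), Matrix.mul_apply,
        Matrix.transpose_apply, Finset.sum_mul, Finset.mul_sum]
      rw [Finset.sum_comm]
      exact Finset.sum_congr rfl fun A _ => Finset.sum_congr rfl fun C _ => by ring
    have hc : ∀ k : ℝ, ContDiffOn ℝ ∞ (fun _ : E3 => k) (φ '' interior B) :=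
      fun k => contDiffOn_const
    have hk : ∀ k : ℝ, pd b (fun _ : E3 => k) (φ X) = 0 := fun k => by simp [pd]
    have hin : ∀ A, ContDiffOn ℝ ∞
        (fun y => ∑ C, F b C * T (Function.invFunOn φ B y) A C) (φ '' interior B) :=
      fun A => ContDiffOn.sum fun C _ => (hc _).mul (ht A C)
    rw [pd_congr hU e b hx, pd_sum _ hU (fun A => (hc _).mul (hin A)) b hx]
    refine Finset.sum_congr rfl fun A _ => ?_
    rw [pd_mul hU (hc _) (hin A) b hx, hk, zero_mul, zero_add,
      pd_sum _ hU (fun C => (hc _).mul (ht A C)) b hx]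
    congr 1
    refine Finset.sum_congr rfl fun C _ => ?_
    rw [pd_mul hU (hc _) (ht A C) b hx, hk, zero_mul, zero_add]
  rw [tensorDiv_eq_sum_pd]
  simp only [h1, Matrix.mulVec, dotProduct]
  rw [Finset.sum_comm]
  refine Finset.sum_congr rfl fun A _ => ?_
  rw [← Finset.mul_sum, Finset.sum_comm, tensorDiv_eq_sum_pd]
  congr 1
  refine Finset.sum_congr rfl fun C _ => ?_
  have h2 : ∀ b, F b C * pd b (fun y => T (Function.invFunOn φ B y) A C) (φ X)
      = ∑ D, pd D (fun Z => T Z A C) X * (inverseGradient B φ (φ X) D b * F b C) := by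
    intro b
    rw [hφ.pd_comp_invFunOn (f := fun Z => T Z A C) hX
      (differentiableAt_of_smoothOn isOpen_interior (hT A C) hX) b, Finset.mul_sum]
    exact Finset.sum_congr rfl fun D _ => by ring
  simp only [h2]
  rw [Finset.sum_comm]
  simp only [← Finset.mul_sum, ← Matrix.mul_apply, hPF]
  simp [Matrix.one_apply]

end Pullback

/-! ### Universal residual stresses vanish -/

section ResidualStress

open MeasureTheory

variable {B : Set E3} {φ : E3 → E3} {S : E3 → Tensor2}

/-- Smoothness up to the boundary and compactness of `B` give one constant for the values and the
derivatives of the whole finite family. -/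
theorem exists_bound_of_contDiffOn (hB : IsBody B) (hbdd : Bornology.IsBounded B)
    {ι : Type*} [Finite ι] {f : ι → E3 → ℝ} (hf : ∀ i, ContDiffOn ℝ ∞ (f i) B) :
    ∃ K, 0 ≤ K ∧ ∀ i, (∀ x ∈ interior B, ‖fderiv ℝ (f i) x‖ ≤ K) ∧
      ∀ x ∈ interior B, |f i x| ≤ K := by
  have hc : IsCompact B := Metric.isCompact_of_isClosed_isBounded hB.isClosed hbdd
  have h1 : ∀ i, ∃ K, (∀ x ∈ interior B, ‖fderiv ℝ (f i) x‖ ≤ K) ∧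
      ∀ x ∈ interior B, |f i x| ≤ K := by
    intro i
    obtain ⟨K₁, hK₁⟩ := hc.exists_bound_of_continuousOn
      ((hf i).continuousOn_fderivWithin hB.uniqueDiffOn (by simp))
    obtain ⟨K₂, hK₂⟩ := hc.exists_bound_of_continuousOn (hf i).continuousOn
    refine ⟨max K₁ K₂, fun x hx => ?_, fun x hx => ?_⟩
    · rw [← fderivWithin_of_mem_nhds (mem_interior_iff_mem_nhds.1 hx)]
      exact (hK₁ x (interior_subset hx)).trans (le_max_left _ _)
    · exact (hK₂ x (interior_subset hx)).trans (le_max_right _ _)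
  choose K hK using h1
  obtain ⟨M, hM⟩ := (Set.finite_range K).bddAbove
  have hle : ∀ i, K i ≤ max 0 M := fun i => (hM (Set.mem_range_self i)).trans (le_max_right _ _)
  exact ⟨max 0 M, le_max_left _ _, fun i =>
    ⟨fun x hx => ((hK i).1 x hx).trans (hle i), fun x hx => ((hK i).2 x hx).trans (hle i)⟩⟩

/-- A divergence-free tensor field on a bounded body that annihilates the boundary normals has
zero mean trace. -/
theorem setIntegral_trace_eq_zero (hB : IsBody B) (hbdd : Bornology.IsBounded B)
    {T : E3 → Tensor2} (hT : ∀ a b, ContDiffOn ℝ ∞ (fun X => T X a b) B)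
    (hdiv : ∀ X ∈ interior B, tensorDiv T X = 0)
    (htan : ∀ x, ∀ y ∈ frontier B, Metric.ball x (dist x y) ⊆ B →
      T y *ᵥ (fun i => (x - y) i) = 0) :
    ∫ X in interior B, (T X).trace = 0 := by
  obtain ⟨R, hR⟩ := hbdd.subset_closedBall 0
  -- Row `a` of `T` is a tangential divergence-free vector field; its `a`-th component is the
  -- diagonal entry.
  have hdiag : ∀ a, ∫ X in interior B, T X a a = 0 := by
    intro a
    obtain ⟨K, hK0, hK⟩ := exists_bound_of_contDiffOn hB hbdd (hT a)
    refine setIntegral_eq_zero_of_div_eq_zero (v := fun b X => T X a b)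
      (fun b x hx => differentiableAt_of_smoothOn isOpen_interior
        ((hT a b).mono interior_subset) hx)
      (fun b => (hK b).1) hK0 (fun b => (hK b).2) hK0 isOpen_interior
      (interior_subset.trans hR) ?_ ?_ ?_ a
    · intro b
      rw [hB.closure_interior]
      exact (hT a b).continuousOn
    · intro x _ y hy hxy
      refine congrFun (htan x y (frontier_interior_subset hy) ?_) a
      rw [← hxy]
      exact Metric.ball_infDist_compl_subset.trans interior_subset
    · exact fun x hx => congrFun (hdiv x hx) a
  have hint : ∀ a, IntegrableOn (fun X => T X a a) (interior B) := fun a =>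
    ((hT a a).continuousOn.integrableOn_compact
      (Metric.isCompact_of_isClosed_isBounded hB.isClosed hbdd)).mono_set interior_subset
  simp only [Matrix.trace, Matrix.diag]
  rw [integral_finsetSum _ fun a _ => hint a]
  simp [hdiag]

/-- On a bounded body the only universal residual stress is zero. -/
theorem IsUniversalPair.residualStress_eq_zero (hB : IsBody B) (hbdd : Bornology.IsBounded B)
    (h : IsUniversalPair B φ S) : ∀ X ∈ B, S X = 0 := by
  have hφ := h.isDeformation
  have hS := h.isResidualStress
  obtain ⟨Z, hZ⟩ := hB.isConnected_interior.nonempty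
  set F := deformationGradient B φ Z with hFdef
  have hF : ∀ X ∈ interior B, deformationGradient B φ X = F :=
    fun X hX => h.deformationGradient_eq hB hX hZ
  have hinv := hφ.inverseGradient_mul hZ
  rw [← hFdef] at hinv
  set P := inverseGradient B φ (φ Z)
  -- Chosen so that `F T Fᵀ = (F S Fᵀ)²`, the stress of the fourth response function alone.
  set T : E3 → Tensor2 := fun X => S X * (Fᵀ * F) * S X with hTdef
  have hT : ∀ a b, ContDiffOn ℝ ∞ (fun X => T X a b) B := by
    intro a b
    simp only [hTdef, Matrix.mul_apply]
    exact ContDiffOn.sum fun c _ => (ContDiffOn.sum fun d _ =>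
      (hS.smooth a d).mul contDiffOn_const).mul (hS.smooth c b)
  have hdiv : ∀ X ∈ interior B, tensorDiv T X = 0 := by
    intro X hX
    have h1 := hφ.tensorDiv_pushforward hF (T := T)
      (σ := cauchyStress (singleResponse 4 fun _ => 1) B φ S)
      (fun a b => (hT a b).mono interior_subset) (fun Y hY => by
        rw [hφ.cauchyStress_apply (interior_subset hY), stressFunction_sq, pushedResidualStress,
          hF Y hY]
        simp only [hTdef, Matrix.mul_assoc]) hX
    have h2 : tensorDiv (cauchyStress (singleResponse 4 fun _ => 1) B φ S) (φ X) = 0 :=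
      funext fun a => h.equilibrium _
        (isResponse_singleResponse 4 (contDiffOn_const (c := (1 : ℝ)))) _
        (Set.mem_image_of_mem φ hX) a
    rw [h2] at h1
    have h3 := congrArg (fun w => P *ᵥ w) h1
    simpa [Matrix.mulVec_mulVec, hinv] using h3.symm
  have htan : ∀ x, ∀ y ∈ frontier B, Metric.ball x (dist x y) ⊆ B →
      T y *ᵥ (fun i => (x - y) i) = 0 := by
    intro x y hy hball
    rw [hTdef]
    simp only
    rw [← Matrix.mulVec_mulVec, hS.mulVec_sub_eq_zero hB hy hball, Matrix.mulVec_zero]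
  -- Symmetry of `S` exhibits the trace as a squared Frobenius norm, nonnegative and zero only when
  -- `F S = 0`.
  have htr : ∀ X ∈ B, (T X).trace = ((F * S X)ᴴ * (F * S X)).trace := by
    intro X hX
    rw [Matrix.conjTranspose_eq_transpose_of_trivial, Matrix.transpose_mul, (hS.symm X hX).eq]
    simp only [hTdef, Matrix.mul_assoc]
  have hcont : ContinuousOn (fun X => (T X).trace) B := by
    simp only [Matrix.trace, Matrix.diag]
    exact continuousOn_finsetSum _ fun a _ => (hT a a).continuousOn
  have hnonneg : ∀ X ∈ interior B, 0 ≤ (T X).trace := by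
    intro X hX
    rw [htr X (interior_subset hX)]
    exact (Matrix.posSemidef_conjTranspose_mul_self _).trace_nonneg
  have hzero := setIntegral_trace_eq_zero hB hbdd hT hdiv htan
  rw [setIntegral_eq_zero_iff_of_nonneg_ae
    ((ae_restrict_iff' isOpen_interior.measurableSet).2 (Filter.Eventually.of_forall hnonneg))
    ((hcont.integrableOn_compact
      (Metric.isCompact_of_isClosed_isBounded hB.isClosed hbdd)).mono_set interior_subset)]
    at hzero
  have hTz := Measure.eqOn_open_of_ae_eq hzero isOpen_interior (hcont.mono interior_subset)
    continuousOn_const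
  have hTzB := hB.eqOn_of_eqOn_interior hcont continuousOn_const hTz
  intro X hX
  have h1 : (T X).trace = 0 := hTzB hX
  rw [htr X hX, Matrix.trace_conjTranspose_mul_self_eq_zero_iff] at h1
  have h2 := congrArg (fun w => P * w) h1
  simpa [← Matrix.mul_assoc, hinv] using h2

end ResidualStress

end ResidualElasticity

open ResidualElasticity
theorem mainTheorem1 (B : Set E3) (hB : IsBody B) :
    (∀ φ : E3 → E3, IsDeformation B φ →
      (IsUniversalDeformation B φ ↔ IsHomogeneousDeformation B φ)) ∧
    (Bornology.IsBounded B → ∀ S : E3 → Tensor2,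
      (IsUniversalResidualStress B S → IsHomogeneousField B S) ∧
      (IsUniversalResidualStress B S ↔ ∀ X ∈ B, S X = 0)) := by
  refine ⟨fun φ hφ => ⟨?_, fun h => ?_⟩, fun hbdd S => ⟨?_, ?_, fun h => ?_⟩⟩
  · rintro ⟨S, hS⟩
    exact hS.isHomogeneousDeformation hB
  · exact ⟨fun _ => 0, h.isUniversalPair hB hφ fun _ _ => rfl⟩
  · rintro ⟨φ, hφ⟩
    exact ⟨0, hφ.residualStress_eq_zero hB hbdd⟩
  · rintro ⟨φ, hφ⟩
    exact hφ.residualStress_eq_zero hB hbdd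
  -- The zero field is universal because it pairs with the undeformed state.
  · exact ⟨id, isHomogeneousDeformation_id.isUniversalPair hB (isDeformation_id hB) h⟩
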